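/- Let $\Delta\subsetneq\mathbb C$ be a simply connected domain, let $f:\mathbb D\to\Delta$ be a Riemann map (a biholomorphism of the open unit disc $\mathbb D$ onto $\Delta$), and let $\{z_n\}\subset\Delta$ be a compactly divergent sequence, i.e. a sequence with no accumulation points in $\Delta$. Then the following are equivalent. (A) There is a point $\sigma\in\partial\mathbb D$ such that $\{f^{-1}(z_n)\}$ converges non-tangentially to $\sigma$, that is, $f^{-1}(z_n)\to\sigma$ and, for some $M>1$, $f^{-1}(z_n)$ is eventually contained in $\{\zeta\in\mathbb D: |\sigma-\zeta|<M(1-|\zeta|)\}$. (B) There exist a simply connected domain $U\subsetneq\mathbb C$, a geodesic $\gamma:[0,+\infty)\to U$ of $U$ with $\lim_{t\to+\infty}k_U(\gamma(t),\gamma(0))=+\infty$, and real numbers $R>R_0>0$ such that 1. $S_U(\gamma,R)\subseteq\Delta\subseteq U$, and 2. there exists $n_0\ge 0$ such that $z_n\in S_U(\gamma,R_0)$ for all $n\ge n_0$. Here, for a simply connected domain $U\subsetneq\mathbb C$, $z\in U$ and $v\in\mathbb C$, $\kappa_U(z;v)=|v|/g'(0)$, where $g:\mathbb D\to U$ is the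 Riemann map with $g(0)=z$ and $g'(0)>0$; the hyperbolic distance $k_U(z,w)$ is the infimum of $\int_0^1\kappa_U(\eta(t);\eta'(t))\,dt$ over all piecewise $C^1$-smooth curves $\eta:[0,1]\to U$ with $\eta(0)=z$, $\eta(1)=w$; a geodesic $\gamma:[0,+\infty)\to U$ is a $C^1$-smooth curve with nowhere vanishing derivative (one-sided at $0$) such that $\int_s^t\kappa_U(\gamma(u);\gamma'(u))\,du=k_U(\gamma(s),\gamma(t))$ for all $0\le s\le t$; and $S_U(\gamma,r)=\{w\in U:\inf_{t\ge0}k_U(w,\gamma(t))<r\}$ for $r>0$. -/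

import Mathlib

open Set Filter Topology

noncomputable section

namespace HypSector

/-- A simply connected domain `Δ ⊊ ℂ` (non-empty and path connected by `IsSimplyConnected`). -/
def IsProperSCDomain (Δ : Set ℂ) : Prop :=
  IsOpen Δ ∧ IsSimplyConnected Δ ∧ Δ ≠ univ

/-- `f` is a Riemann map of `Δ`: a biholomorphism from the open unit disc onto `Δ`
(only the values of `f` on the disc matter). -/
def IsRiemannMap (f : ℂ → ℂ) (Δ : Set ℂ) : Prop :=
  DifferentiableOn ℂ f (Metric.ball 0 1) ∧ BijOn f (Metric.ball 0 1) Δ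

/-- The infinitesimal hyperbolic metric `κ_Δ(z; v) = |v| / f'(0)`, where `f` is the Riemann map
of `Δ` with `f(0) = z` and `f'(0) > 0`. Such an `f` is unique on the disc, so for `z` in a simply
connected domain `Δ ⊊ ℂ` the set below has exactly one element and `sInf` picks it. -/
def kappa (Δ : Set ℂ) (z v : ℂ) : ℝ :=
  sInf {r : ℝ | ∃ f : ℂ → ℂ, IsRiemannMap f Δ ∧ f 0 = z ∧
    0 < (deriv f 0).re ∧ (deriv f 0).im = 0 ∧ r = ‖v‖ / (deriv f 0).re}

/-- Piecewise `C¹`-smooth curves on `[a, b]`: continuous, and `C¹` up to the end points on each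
closed interval of some finite partition `a = t 0 ≤ t 1 ≤ ⋯ ≤ t n = b`. -/
def IsPiecewiseC1 (γ : ℝ → ℂ) (a b : ℝ) : Prop :=
  ContinuousOn γ (Icc a b) ∧ ∃ (n : ℕ) (t : ℕ → ℝ), Monotone t ∧ t 0 = a ∧ t n = b ∧
    ∀ i < n, ContDiffOn ℝ 1 γ (Icc (t i) (t (i + 1)))

/-- The hyperbolic length `ℓ_Δ(γ; [s, t])`. -/
def hypLength (Δ : Set ℂ) (γ : ℝ → ℂ) (s t : ℝ) : ℝ :=
  ∫ u in s..t, kappa Δ (γ u) (deriv γ u)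

/-- The hyperbolic distance `k_Δ(z, w)`: the infimum of the hyperbolic lengths of the piecewise
`C¹`-smooth curves in `Δ` from `z` to `w`. -/
def hypDist (Δ : Set ℂ) (z w : ℂ) : ℝ :=
  sInf {L : ℝ | ∃ γ : ℝ → ℂ, IsPiecewiseC1 γ 0 1 ∧ MapsTo γ (Icc 0 1) Δ ∧
    γ 0 = z ∧ γ 1 = w ∧ L = hypLength Δ γ 0 1}

/-- `γ : I → Δ`, with `I` an interval, is a geodesic of `Δ`: it is `C¹`-smooth with nowhere
vanishing derivative (one-sided at end points of `I` that belong to `I`), and hyperbolic length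
along `γ` equals hyperbolic distance. -/
def IsGeodesic (Δ : Set ℂ) (γ : ℝ → ℂ) (I : Set ℝ) : Prop :=
  MapsTo γ I Δ ∧ ContDiffOn ℝ 1 γ I ∧ (∀ t ∈ I, derivWithin γ I t ≠ 0) ∧
    ∀ s ∈ I, ∀ t ∈ I, s ≤ t → hypLength Δ γ s t = hypDist Δ (γ s) (γ t)

/-- The hyperbolic distance `k_Δ(w, A) = inf_{a ∈ A} k_Δ(w, a)` from a point to a set. -/
def hypInfDist (Δ : Set ℂ) (w : ℂ) (A : Set ℂ) : ℝ :=
  sInf (hypDist Δ w '' A)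

/-- The hyperbolic sector `S_Δ(γ, R)` around `γ : [0, +∞) → Δ` of amplitude `R`. -/
def sector (Δ : Set ℂ) (γ : ℝ → ℂ) (R : ℝ) : Set ℂ :=
  {w | w ∈ Δ ∧ hypInfDist Δ w (γ '' Ici 0) < R}

/-- The sequence `z` has no accumulation points in `Δ`. -/
def CompactlyDivergent (Δ : Set ℂ) (z : ℕ → ℂ) : Prop :=
  ∀ w ∈ Δ, ¬ MapClusterPt w atTop z

/-- The sequence `ζ` converges to `σ` and is eventually contained in a Stolz region
`{ζ ∈ 𝔻 : |σ - ζ| < M (1 - |ζ|)}`, `M > 1`, of vertex `σ`. -/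
def ConvergesNonTangentially (ζ : ℕ → ℂ) (σ : ℂ) : Prop :=
  Tendsto ζ atTop (𝓝 σ) ∧
    ∃ M : ℝ, 1 < M ∧ ∀ᶠ n in atTop, ζ n ∈ Metric.ball (0 : ℂ) 1 ∧ ‖σ - ζ n‖ < M * (1 - ‖ζ n‖)

end HypSector

end

namespace HypSector

open scoped ComplexConjugate
open MeasureTheory

/-! ### Injective holomorphic functions -/

/-! For (A) ⇒ (B) take `U = Δ` and let `γ` be the `f`-image of the radius ending at `σ`, at unit
hyperbolic speed. A point `w` of a Stolz region lies within bounded hyperbolic distance of `σ * ‖w‖`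
(`discDist_norm_mul_le`), so the sequence enters a sector.

For (B) ⇒ (A) put `m = κ_U(γ; γ')`. The sector of amplitude `R` contains every `k_U`-disc of radius
`R` centred on `γ`, so the Schwarz lemma gives `κ_Δ ≤ κ_U / tanh R` along `γ`, while `Δ ⊆ U` gives
`k_U ≤ k_Δ`. Hence `f⁻¹ ∘ γ` is a quasi-geodesic of the disc with constant `C = 1 / tanh R`
(`isQuasiGeodesicRay`). Stability of quasi-geodesics is proved by contraction: away from a diameter,
projection to the diameter shrinks length, so a long excursion would be too inefficient
(`le_axisCos`). This puts each initial arc in a Stolz region whose constant does not depend on the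
arc, and compactness of the circle yields one vertex for the whole ray (`exists_stolz`). Finally `R₀
< R` and the Schwarz lemma bound the `k_Δ`-distance from `z n` to `γ`; Stolz regions absorb bounded
hyperbolic neighbourhoods (`stolz_of_discDist_le`), and compact divergence forces `‖f⁻¹(z n)‖ → 1`.

Distances are computable because a Riemann map turns `hypDist` into the explicit `discDist`
(`hypDist_apply`). A Riemann map of `U` comes from the Riemann mapping theorem, proved below by
Koebe's extremal argument. -/

theorem not_eventually_const_of_injOn {f : ℂ → ℂ} {s : Set ℂ} (hs : IsOpen s) (hinj : InjOn f s)
    {z : ℂ} (hz : z ∈ s) : ¬ ∀ᶠ w in 𝓝 z, f w = f z := by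
  intro h
  have h1 : ∀ᶠ w in 𝓝[≠] z, w = z := by
    filter_upwards [h.filter_mono nhdsWithin_le_nhds,
      nhdsWithin_le_nhds (hs.mem_nhds hz)] with w hw hws
    exact hinj hws hz hw
  have h2 : ∀ᶠ w in 𝓝[≠] z, w ≠ z := eventually_mem_nhdsWithin
  obtain ⟨w, hw1, hw2⟩ := (h1.and h2).exists
  exact hw2 hw1

theorem nhds_le_map_nhds_of_injOn {f : ℂ → ℂ} {s : Set ℂ} (hs : IsOpen s)
    (hf : DifferentiableOn ℂ f s) (hinj : InjOn f s) {z : ℂ} (hz : z ∈ s) :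
    𝓝 (f z) ≤ map f (𝓝 z) :=
  ((hf.analyticAt (hs.mem_nhds hz)).eventually_constant_or_nhds_le_map_nhds).resolve_left
    (not_eventually_const_of_injOn hs hinj hz)

theorem continuousAt_invFunOn {f : ℂ → ℂ} {s : Set ℂ} (hs : IsOpen s)
    (hf : DifferentiableOn ℂ f s) (hinj : InjOn f s) {z : ℂ} (hz : z ∈ s) :
    ContinuousAt (Function.invFunOn f s) (f z) := by
  have h : Tendsto (Function.invFunOn f s) (map f (𝓝 z)) (𝓝 z) := by
    rw [tendsto_map'_iff]
    refine tendsto_id.congr' ?_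
    filter_upwards [hs.mem_nhds hz] with w hw
    exact (hinj.leftInvOn_invFunOn hw).symm
  unfold ContinuousAt
  rw [hinj.leftInvOn_invFunOn hz]
  exact h.mono_left (nhds_le_map_nhds_of_injOn hs hf hinj hz)

theorem eventually_right_inv {f : ℂ → ℂ} {s : Set ℂ} (hs : IsOpen s)
    (hf : DifferentiableOn ℂ f s) (hinj : InjOn f s) {z : ℂ} (hz : z ∈ s) :
    ∀ᶠ w in 𝓝 (f z), f (Function.invFunOn f s w) = w := by
  refine nhds_le_map_nhds_of_injOn hs hf hinj hz (mem_map.2 ?_)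
  filter_upwards [hs.mem_nhds hz] with w hw
  rw [mem_preimage, mem_ofPred_eq, hinj.leftInvOn_invFunOn hw]

/-- Zeros of `f'` are isolated, so the inverse is holomorphic on a punctured neighbourhood of `f z`.
Being continuous there, it has a removable singularity, and the chain rule for `g ∘ f = id` excludes
`f' = 0`. -/
theorem deriv_ne_zero_of_injOn {f : ℂ → ℂ} {s : Set ℂ} (hs : IsOpen s)
    (hf : DifferentiableOn ℂ f s) (hinj : InjOn f s) {z : ℂ} (hz : z ∈ s) : deriv f z ≠ 0 := by
  set g := Function.invFunOn f s
  have hfz := hf.analyticAt (hs.mem_nhds hz)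
  have hne : ∀ᶠ w in 𝓝[≠] z, deriv f w ≠ 0 := by
    refine hfz.deriv.eventually_eq_zero_or_eventually_ne_zero.resolve_left fun h0 => ?_
    obtain ⟨r, hr, hball⟩ := Metric.eventually_nhds_iff_ball.1 (h0.and (hs.mem_nhds hz))
    refine not_eventually_const_of_injOn hs hinj hz ?_
    filter_upwards [Metric.ball_mem_nhds z hr] with w hw
    refine (convex_ball z r).is_const_of_fderivWithin_eq_zero (𝕜 := ℂ)
      (hf.mono fun w hw => (hball w hw).2) (fun w hw => ?_) hw (Metric.mem_ball_self hr)
    rw [fderivWithin_of_isOpen Metric.isOpen_ball hw]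
    ext
    simpa using (hball w hw).1
  have hd : ∀ᶠ w in 𝓝[≠] (f z), DifferentiableAt ℂ g w := by
    have h1 : ∀ᶠ x in 𝓝 z, x ≠ z → DifferentiableAt ℂ g (f x) := by
      filter_upwards [eventually_nhdsWithin_iff.1 hne, hs.mem_nhds hz] with x hx hxs hxz
      have hgx : g (f x) = x := hinj.leftInvOn_invFunOn hxs
      refine (HasDerivAt.of_local_left_inverse (f := f) (f' := deriv f x)
        (continuousAt_invFunOn hs hf hinj hxs) ?_ (hx hxz)
        (eventually_right_inv hs hf hinj hxs)).differentiableAt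
      rw [show Function.invFunOn f s (f x) = x from hgx]
      exact (hf.differentiableAt (hs.mem_nhds hxs)).hasDerivAt
    have h2 : ∀ᶠ w in 𝓝 (f z), w ≠ f z → DifferentiableAt ℂ g w := by
      refine nhds_le_map_nhds_of_injOn hs hf hinj hz (mem_map.2 ?_)
      filter_upwards [h1] with x hx hxz
      exact hx fun h => hxz (by rw [h])
    exact eventually_nhdsWithin_iff.2 h2
  have hg : DifferentiableAt ℂ g (f z) :=
    (Complex.analyticAt_of_differentiable_on_punctured_nhds_of_continuousAt hd
      (continuousAt_invFunOn hs hf hinj hz)).differentiableAt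
  have hcomp : HasDerivAt (g ∘ f) (deriv g (f z) * deriv f z) z :=
    hg.hasDerivAt.comp z hfz.differentiableAt.hasDerivAt
  have hid : HasDerivAt (g ∘ f) 1 z := by
    refine (hasDerivAt_id z).congr_of_eventuallyEq ?_
    filter_upwards [hs.mem_nhds hz] with w hw
    exact hinj.leftInvOn_invFunOn hw
  intro h0
  have := hcomp.unique hid
  simp [h0] at this

theorem hasDerivAt_invFunOn {f : ℂ → ℂ} {s : Set ℂ} (hs : IsOpen s)
    (hf : DifferentiableOn ℂ f s) (hinj : InjOn f s) {z : ℂ} (hz : z ∈ s) :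
    HasDerivAt (Function.invFunOn f s) (deriv f z)⁻¹ (f z) := by
  refine HasDerivAt.of_local_left_inverse (f := f) (continuousAt_invFunOn hs hf hinj hz) ?_
    (deriv_ne_zero_of_injOn hs hf hinj hz) (eventually_right_inv hs hf hinj hz)
  rw [hinj.leftInvOn_invFunOn hz]
  exact (hf.differentiableAt (hs.mem_nhds hz)).hasDerivAt

/-! ### Riemann maps -/

/-- The inverse of a Riemann map. -/
noncomputable def rinv (f : ℂ → ℂ) : ℂ → ℂ := Function.invFunOn f (Metric.ball 0 1)

namespace IsRiemannMap

variable {f : ℂ → ℂ} {U : Set ℂ}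

theorem mem (hf : IsRiemannMap f U) {z : ℂ} (hz : ‖z‖ < 1) : f z ∈ U :=
  hf.2.mapsTo (by simpa using hz)

theorem rinv_apply (hf : IsRiemannMap f U) {z : ℂ} (hz : ‖z‖ < 1) : rinv f (f z) = z :=
  hf.2.injOn.leftInvOn_invFunOn (by simpa using hz)

theorem norm_rinv_lt (hf : IsRiemannMap f U) {w : ℂ} (hw : w ∈ U) : ‖rinv f w‖ < 1 := by
  simpa [rinv] using Function.invFunOn_mem (hf.2.surjOn hw)

theorem apply_rinv (hf : IsRiemannMap f U) {w : ℂ} (hw : w ∈ U) : f (rinv f w) = w :=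
  Function.invFunOn_eq (hf.2.surjOn hw)

theorem differentiableAt (hf : IsRiemannMap f U) {z : ℂ} (hz : ‖z‖ < 1) :
    DifferentiableAt ℂ f z :=
  hf.1.differentiableAt (Metric.isOpen_ball.mem_nhds (by simpa using hz))

theorem deriv_ne_zero (hf : IsRiemannMap f U) {z : ℂ} (hz : ‖z‖ < 1) : deriv f z ≠ 0 :=
  deriv_ne_zero_of_injOn Metric.isOpen_ball hf.1 hf.2.injOn (by simpa using hz)

theorem hasDerivAt_rinv (hf : IsRiemannMap f U) {w : ℂ} (hw : w ∈ U) :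
    HasDerivAt (rinv f) (deriv f (rinv f w))⁻¹ w := by
  have := hasDerivAt_invFunOn Metric.isOpen_ball hf.1 hf.2.injOn
    (z := rinv f w) (by simpa using hf.norm_rinv_lt hw)
  rwa [hf.apply_rinv hw] at this

theorem isOpen (hf : IsRiemannMap f U) : IsOpen U := by
  rw [isOpen_iff_mem_nhds]
  intro w hw
  rw [← hf.apply_rinv hw]
  have hz : rinv f w ∈ Metric.ball (0 : ℂ) 1 := by simpa using hf.norm_rinv_lt hw
  refine nhds_le_map_nhds_of_injOn Metric.isOpen_ball hf.1 hf.2.injOn hz (mem_map.2 ?_)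
  filter_upwards [Metric.isOpen_ball.mem_nhds hz] with x hx
  exact hf.2.mapsTo hx

/-- Precomposition of a Riemann map with an automorphism of the disc. -/
theorem comp (hf : IsRiemannMap f U) {φ ψ : ℂ → ℂ} (hφ : DifferentiableOn ℂ φ (Metric.ball 0 1))
    (h1 : MapsTo φ (Metric.ball 0 1) (Metric.ball 0 1))
    (h2 : MapsTo ψ (Metric.ball 0 1) (Metric.ball 0 1))
    (h3 : LeftInvOn ψ φ (Metric.ball 0 1)) (h4 : LeftInvOn φ ψ (Metric.ball 0 1)) :
    IsRiemannMap (f ∘ φ) U :=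
  ⟨hf.1.comp hφ h1, hf.2.comp (InvOn.bijOn ⟨h3, h4⟩ h1 h2)⟩

theorem differentiableOn_rinv_comp (hf : IsRiemannMap f U) {g : ℂ → ℂ} {s : Set ℂ}
    (hs : IsOpen s) (hg : DifferentiableOn ℂ g s) (hm : MapsTo g s U) :
    DifferentiableOn ℂ (rinv f ∘ g) s := fun w hw =>
  ((hf.hasDerivAt_rinv (hm hw)).differentiableAt.comp w
    (hg.differentiableAt (hs.mem_nhds hw))).differentiableWithinAt

theorem mapsTo_closedBall_rinv_comp (hf : IsRiemannMap f U) {g : ℂ → ℂ} {s : Set ℂ}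
    (h0 : g 0 = f 0) (hm : MapsTo g s U) :
    MapsTo (rinv f ∘ g) s (Metric.closedBall ((rinv f ∘ g) 0) 1) := fun w hw => by
  rw [Function.comp_apply, Function.comp_apply, h0, hf.rinv_apply (z := 0) (by simp)]
  simpa using (hf.norm_rinv_lt (hm hw)).le

/-- The Schwarz lemma for maps from a disc into a domain. -/
theorem norm_rinv_le_of_mapsTo (hf : IsRiemannMap f U) {g : ℂ → ℂ} {r : ℝ}
    (hg : DifferentiableOn ℂ g (Metric.ball 0 r)) (h0 : g 0 = f 0)
    (hm : MapsTo g (Metric.ball 0 r) U) {w : ℂ} (hw : ‖w‖ < r) : ‖rinv f (g w)‖ ≤ ‖w‖ / r := by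
  have h := Complex.dist_le_div_mul_dist_of_mapsTo_ball
    (hf.differentiableOn_rinv_comp Metric.isOpen_ball hg hm) (hf.mapsTo_closedBall_rinv_comp h0 hm)
    (z := w) (by simpa using hw)
  simp only [Function.comp_apply, h0, hf.rinv_apply (z := 0) (by simp), dist_zero_right] at h
  rwa [one_div, inv_mul_eq_div] at h

/-- The Schwarz lemma for the derivative of maps from a disc into a domain. -/
theorem norm_deriv_le_of_mapsTo (hf : IsRiemannMap f U) {g : ℂ → ℂ} {r : ℝ} (hr : 0 < r)
    (hg : DifferentiableOn ℂ g (Metric.ball 0 r)) (h0 : g 0 = f 0)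
    (hm : MapsTo g (Metric.ball 0 r) U) : ‖deriv g 0‖ ≤ ‖deriv f 0‖ / r := by
  have hz : ‖(0 : ℂ)‖ < 1 := by simp
  have hder : HasDerivAt (rinv f ∘ g) ((deriv f 0)⁻¹ * deriv g 0) 0 := by
    have h1 : HasDerivAt (rinv f) (deriv f 0)⁻¹ (g 0) := by
      have := hf.hasDerivAt_rinv (hf.mem hz)
      rwa [hf.rinv_apply hz, ← h0] at this
    exact h1.comp 0 (hg.differentiableAt (Metric.ball_mem_nhds 0 hr)).hasDerivAt
  have h := Complex.norm_deriv_le_div_of_mapsTo_ball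
    (hf.differentiableOn_rinv_comp Metric.isOpen_ball hg hm)
    (hf.mapsTo_closedBall_rinv_comp h0 hm) hr
  rw [hder.deriv, norm_mul, norm_inv,
    inv_mul_le_iff₀ (norm_pos_iff.2 (hf.deriv_ne_zero hz)), mul_one_div] at h
  exact h

theorem norm_deriv_le_of_zero {g : ℂ → ℂ} (hf : IsRiemannMap f U) (hg : IsRiemannMap g U)
    (h : f 0 = g 0) : ‖deriv f 0‖ ≤ ‖deriv g 0‖ := by
  simpa using hg.norm_deriv_le_of_mapsTo one_pos hf.1 h hf.2.mapsTo

end IsRiemannMap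

/-! ### Automorphisms of the disc -/

/-- The automorphism of the unit disc that moves `0` to `a` and has positive derivative at `0`. -/
noncomputable def mob (a w : ℂ) : ℂ := (w + a) / (1 + conj a * w)

theorem one_add_conj_mul_ne_zero {a w : ℂ} (ha : ‖a‖ < 1) (hw : ‖w‖ ≤ 1) : 1 + conj a * w ≠ 0 := by
  intro h
  have h1 : conj a * w = -1 := by linear_combination h
  have h2 : ‖a‖ * ‖w‖ = 1 := by simpa using congrArg norm h1
  nlinarith [norm_nonneg a, norm_nonneg w]

/-- The identity behind the invariance of the disc, of its metric and of `discDist` under `mob`. -/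
theorem sq_norm_one_add_conj_mul (a w : ℂ) :
    ‖1 + conj a * w‖ ^ 2 = ‖w + a‖ ^ 2 + (1 - ‖a‖ ^ 2) * (1 - ‖w‖ ^ 2) := by
  simp only [← Complex.normSq_eq_norm_sq, Complex.normSq_apply]
  simp
  ring

theorem one_sub_sq_norm_mob {a w : ℂ} (ha : ‖a‖ < 1) (hw : ‖w‖ ≤ 1) :
    1 - ‖mob a w‖ ^ 2 = (1 - ‖a‖ ^ 2) * (1 - ‖w‖ ^ 2) / ‖1 + conj a * w‖ ^ 2 := by
  have h := norm_pos_iff.2 (one_add_conj_mul_ne_zero ha hw)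
  rw [mob, norm_div, div_pow, eq_div_iff (by positivity), sub_mul,
    div_mul_cancel₀ _ (by positivity), sq_norm_one_add_conj_mul]
  ring

theorem one_sub_sq_pos {x : ℝ} (h0 : 0 ≤ x) (h : x < 1) : 0 < 1 - x ^ 2 := by nlinarith

theorem norm_mob_lt_one {a w : ℂ} (ha : ‖a‖ < 1) (hw : ‖w‖ < 1) : ‖mob a w‖ < 1 := by
  have h := norm_pos_iff.2 (one_add_conj_mul_ne_zero ha hw.le)
  have h1 := one_sub_sq_norm_mob ha hw.le
  have h2 : 0 < (1 - ‖a‖ ^ 2) * (1 - ‖w‖ ^ 2) / ‖1 + conj a * w‖ ^ 2 := by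
    have := one_sub_sq_pos (norm_nonneg a) ha
    have := one_sub_sq_pos (norm_nonneg w) hw
    positivity
  nlinarith [norm_nonneg (mob a w)]

theorem mob_zero (a : ℂ) : mob a 0 = a := by simp [mob]

theorem mob_neg_mob {a w : ℂ} (ha : ‖a‖ < 1) (hw : ‖w‖ ≤ 1) : mob (-a) (mob a w) = w := by
  have h := one_add_conj_mul_ne_zero ha hw
  have h2 : (1 : ℂ) - conj a * a ≠ 0 := by
    have := one_add_conj_mul_ne_zero (a := a) (w := -a) ha (by simpa using ha.le)
    intro h; apply this; linear_combination h
  have h3 : mob a w - a = (1 - conj a * a) * w / (1 + conj a * w) := by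
    rw [mob, div_sub' h]; congr 1; ring
  have h4 : 1 - conj a * mob a w = (1 - conj a * a) / (1 + conj a * w) := by
    rw [mob, mul_div_assoc', one_sub_div h]; congr 1; ring
  rw [mob, map_neg, ← sub_eq_add_neg, neg_mul, ← sub_eq_add_neg, h3, h4]
  field_simp

theorem mob_mob_neg {a w : ℂ} (ha : ‖a‖ < 1) (hw : ‖w‖ ≤ 1) : mob a (mob (-a) w) = w := by
  have := mob_neg_mob (a := -a) (w := w) (by simpa using ha) hw
  rwa [neg_neg] at this

theorem hasDerivAt_mob {a w : ℂ} (ha : ‖a‖ < 1) (hw : ‖w‖ ≤ 1) :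
    HasDerivAt (mob a) ((1 - conj a * a) / (1 + conj a * w) ^ 2) w := by
  have h := one_add_conj_mul_ne_zero ha hw
  have := ((hasDerivAt_id w).add_const a).div (((hasDerivAt_id w).const_mul (conj a)).const_add 1) h
  refine this.congr_deriv ?_
  simp only [id]
  ring

theorem mob_sub_mob {a w z : ℂ} (ha : ‖a‖ < 1) (hw : ‖w‖ ≤ 1) (hz : ‖z‖ ≤ 1) :
    mob a w - mob a z =
      (1 - conj a * a) * (w - z) / ((1 + conj a * w) * (1 + conj a * z)) := by
  have h := one_add_conj_mul_ne_zero ha hw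
  have h' := one_add_conj_mul_ne_zero ha hz
  rw [mob, mob, div_sub_div _ _ h h']; congr 1; ring

theorem norm_one_sub_conj_mul_self {a : ℂ} (ha : ‖a‖ < 1) :
    ‖(1 : ℂ) - conj a * a‖ = 1 - ‖a‖ ^ 2 := by
  rw [mul_comm, Complex.mul_conj, Complex.normSq_eq_norm_sq, ← Complex.ofReal_one,
    ← Complex.ofReal_sub, Complex.norm_real,
    Real.norm_of_nonneg (one_sub_sq_pos (norm_nonneg a) ha).le]

namespace IsRiemannMap

variable {f : ℂ → ℂ} {U : Set ℂ}

theorem comp_mob (hf : IsRiemannMap f U) {a : ℂ} (ha : ‖a‖ < 1) : IsRiemannMap (f ∘ mob a) U := by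
  have ha' : ‖-a‖ < 1 := by simpa using ha
  refine hf.comp (ψ := mob (-a)) ?_ ?_ ?_ ?_ ?_
  · intro z hz
    exact (hasDerivAt_mob ha (le_of_lt (by simpa using hz))).differentiableAt.differentiableWithinAt
  · intro z hz
    simpa using norm_mob_lt_one ha (by simpa using hz)
  · intro z hz
    simpa using norm_mob_lt_one ha' (by simpa using hz)
  · intro z hz
    exact mob_neg_mob ha (le_of_lt (by simpa using hz))
  · intro z hz
    exact mob_mob_neg ha (le_of_lt (by simpa using hz))

theorem hasDerivAt_comp_mob (hf : IsRiemannMap f U) {a : ℂ} (ha : ‖a‖ < 1) :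
    HasDerivAt (f ∘ mob a) (deriv f a * (1 - conj a * a)) 0 := by
  have h1 := hasDerivAt_mob (a := a) (w := 0) ha (by simp)
  have h2 := (hf.differentiableAt ha).hasDerivAt
  rw [← mob_zero a] at h2
  have := h2.comp 0 h1
  rw [mob_zero] at this
  simpa using this

theorem comp_rotation (hf : IsRiemannMap f U) {u : ℂ} (hu : ‖u‖ = 1) :
    IsRiemannMap (f ∘ fun z => u * z) U := by
  have hu0 : u ≠ 0 := by rintro rfl; simp at hu
  refine hf.comp (ψ := fun z => u⁻¹ * z) (by fun_prop) ?_ ?_ ?_ ?_ <;> intro z hz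
  · simpa [hu] using hz
  · simpa [hu] using hz
  · simp [hu0]
  · simp [hu0]

theorem norm_deriv_eq_of_zero {g : ℂ → ℂ} (hf : IsRiemannMap f U) (hg : IsRiemannMap g U)
    (h : f 0 = g 0) : ‖deriv f 0‖ = ‖deriv g 0‖ :=
  le_antisymm (hf.norm_deriv_le_of_zero hg h) (hg.norm_deriv_le_of_zero hf h.symm)

/-- The hyperbolic metric in the coordinate given by an arbitrary Riemann map. -/
theorem kappa_apply (hf : IsRiemannMap f U) {a : ℂ} (ha : ‖a‖ < 1) (v : ℂ) :
    kappa U (f a) v = ‖v‖ / (‖deriv f a‖ * (1 - ‖a‖ ^ 2)) := by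
  have hd := hf.hasDerivAt_comp_mob ha
  have hnorm : ‖deriv (f ∘ mob a) 0‖ = ‖deriv f a‖ * (1 - ‖a‖ ^ 2) := by
    rw [hd.deriv, norm_mul, norm_one_sub_conj_mul_self ha]
  have h0 : ‖(0 : ℂ)‖ < 1 := by simp
  have hne := (hf.comp_mob ha).deriv_ne_zero h0
  set d := deriv (f ∘ mob a) 0 with hd_def
  have hdpos : 0 < ‖d‖ := norm_pos_iff.2 hne
  -- The Schwarz lemma in both directions fixes `|g'(0)|`, so the set under `sInf` is a singleton.
  suffices h : {r : ℝ | ∃ g : ℂ → ℂ, IsRiemannMap g U ∧ g 0 = f a ∧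
      0 < (deriv g 0).re ∧ (deriv g 0).im = 0 ∧ r = ‖v‖ / (deriv g 0).re} = {‖v‖ / ‖d‖} by
    rw [kappa, h, csInf_singleton, hnorm]
  ext r
  constructor
  · rintro ⟨g, hg, hg0, hre, him, rfl⟩
    have h1 : ‖deriv g 0‖ = ‖d‖ :=
      hg.norm_deriv_eq_of_zero (hf.comp_mob ha) (by simp [hg0, mob_zero])
    have h2 : deriv g 0 = ((deriv g 0).re : ℂ) := by
      apply Complex.ext <;> simp [him]
    rw [h2, Complex.norm_real, Real.norm_of_nonneg hre.le] at h1
    rw [mem_singleton_iff, h1]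
  · intro hr
    rw [mem_singleton_iff] at hr
    -- Rotating by `conj d / ‖d‖` turns the derivative `d` into the positive number `‖d‖`.
    have hu : ‖conj d / ‖d‖‖ = 1 := by
      rw [norm_div, Complex.norm_conj, Complex.norm_real, norm_norm, div_self hdpos.ne']
    have hder : deriv ((f ∘ mob a) ∘ fun z => conj d / ‖d‖ * z) 0 = (‖d‖ : ℂ) := by
      have h1 : HasDerivAt (f ∘ mob a) d (conj d / ‖d‖ * 0) := by
        rw [mul_zero]; exact ((hf.comp_mob ha).differentiableAt h0).hasDerivAt
      have h2 := h1.comp (0 : ℂ) ((hasDerivAt_id (0 : ℂ)).const_mul (conj d / ‖d‖))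
      have h3 : deriv ((f ∘ mob a) ∘ fun z => conj d / ‖d‖ * z) 0 = d * (conj d / ‖d‖ * 1) :=
        h2.deriv
      rw [h3, mul_one, mul_div_assoc', Complex.mul_conj, Complex.normSq_eq_norm_sq]
      have : (‖d‖ : ℂ) ≠ 0 := by exact_mod_cast hdpos.ne'
      push_cast
      field_simp
    refine ⟨_, (hf.comp_mob ha).comp_rotation hu, by simp [mob_zero], ?_, ?_, ?_⟩ <;>
      rw [hder] <;> simp [hr, hdpos]

end IsRiemannMap

theorem kappa_nonneg (U : Set ℂ) (z v : ℂ) : 0 ≤ kappa U z v := by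
  refine Real.sInf_nonneg ?_
  rintro r ⟨g, -, -, hre, -, rfl⟩
  positivity

/-! ### The hyperbolic distance of the disc -/

/-- The hyperbolic distance of the unit disc in closed form. -/
noncomputable def discDist (a b : ℂ) : ℝ :=
  Real.arsinh (‖a - b‖ / √((1 - ‖a‖ ^ 2) * (1 - ‖b‖ ^ 2)))

theorem discDist_comm (a b : ℂ) : discDist a b = discDist b a := by
  rw [discDist, discDist, norm_sub_rev, mul_comm]

theorem discDist_rotation {u : ℂ} (hu : ‖u‖ = 1) (a b : ℂ) :
    discDist (u * a) (u * b) = discDist a b := by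
  simp [discDist, ← mul_sub, hu]

theorem discDist_zero_left {w : ℂ} (hw : ‖w‖ < 1) : discDist 0 w = Real.artanh ‖w‖ := by
  have h : ‖w‖ ∈ Ioo (-1 : ℝ) 1 := ⟨by linarith [norm_nonneg w], hw⟩
  rw [discDist, ← Real.arsinh_sinh (Real.artanh ‖w‖), Real.sinh_artanh h]
  simp

theorem discDist_mob {c a b : ℂ} (hc : ‖c‖ < 1) (ha : ‖a‖ < 1) (hb : ‖b‖ < 1) :
    discDist (mob c a) (mob c b) = discDist a b := by
  have h1 := norm_pos_iff.2 (one_add_conj_mul_ne_zero hc ha.le)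
  have h2 := norm_pos_iff.2 (one_add_conj_mul_ne_zero hc hb.le)
  have h3 := one_sub_sq_pos (norm_nonneg c) hc
  have e : (1 - ‖mob c a‖ ^ 2) * (1 - ‖mob c b‖ ^ 2) = ((1 - ‖a‖ ^ 2) * (1 - ‖b‖ ^ 2)) *
      ((1 - ‖c‖ ^ 2) / (‖1 + conj c * a‖ * ‖1 + conj c * b‖)) ^ 2 := by
    rw [one_sub_sq_norm_mob hc ha.le, one_sub_sq_norm_mob hc hb.le]
    field_simp
  rw [discDist, discDist, e, Real.sqrt_mul (mul_pos (one_sub_sq_pos (norm_nonneg a) ha)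
    (one_sub_sq_pos (norm_nonneg b) hb)).le, Real.sqrt_sq (by positivity),
    mob_sub_mob hc ha.le hb.le, norm_div, norm_mul, norm_mul, norm_one_sub_conj_mul_self hc]
  congr 1
  have : 0 < √((1 - ‖a‖ ^ 2) * (1 - ‖b‖ ^ 2)) := Real.sqrt_pos.2
    (mul_pos (one_sub_sq_pos (norm_nonneg a) ha) (one_sub_sq_pos (norm_nonneg b) hb))
  generalize ‖1 + conj c * a‖ = x at *
  generalize ‖1 + conj c * b‖ = y at *
  field_simp

theorem discDist_eq_artanh {a b : ℂ} (ha : ‖a‖ < 1) (hb : ‖b‖ < 1) :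
    discDist a b = Real.artanh ‖mob (-a) b‖ := by
  have ha' : ‖-a‖ < 1 := by simpa using ha
  rw [← discDist_mob ha' ha hb, ← discDist_zero_left (norm_mob_lt_one ha' hb)]
  congr 1
  simp [mob]

/-- The conformal map of the disc onto the strip `|Im| < π / 4` that maps the real diameter onto
the real axis. -/
noncomputable def stripMap (w : ℂ) : ℂ := (Complex.log (1 + w) - Complex.log (1 - w)) / 2

theorem one_add_mem_slitPlane {w : ℂ} (hw : ‖w‖ < 1) : 1 + w ∈ Complex.slitPlane := by
  left
  have := Complex.abs_re_le_norm w
  simp only [Complex.add_re, Complex.one_re]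
  linarith [neg_abs_le w.re]

theorem one_sub_mem_slitPlane {w : ℂ} (hw : ‖w‖ < 1) : 1 - w ∈ Complex.slitPlane := by
  rw [sub_eq_add_neg]
  exact one_add_mem_slitPlane (by simpa using hw)

theorem one_sub_sq_ne_zero {w : ℂ} (hw : ‖w‖ < 1) : 1 - w ^ 2 ≠ 0 := by
  have h1 := Complex.slitPlane_ne_zero (one_add_mem_slitPlane hw)
  have h2 := Complex.slitPlane_ne_zero (one_sub_mem_slitPlane hw)
  rw [show 1 - w ^ 2 = (1 + w) * (1 - w) by ring]
  exact mul_ne_zero h1 h2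

theorem hasDerivAt_stripMap {w : ℂ} (hw : ‖w‖ < 1) :
    HasDerivAt stripMap (1 - w ^ 2)⁻¹ w := by
  have h1 := ((hasDerivAt_id w).const_add 1).clog (one_add_mem_slitPlane hw)
  have h2 := ((hasDerivAt_id w).const_sub 1).clog (one_sub_mem_slitPlane hw)
  refine ((h1.sub h2).div_const 2).congr_deriv ?_
  have h3 := Complex.slitPlane_ne_zero (one_add_mem_slitPlane hw)
  have h4 := Complex.slitPlane_ne_zero (one_sub_mem_slitPlane hw)
  rw [show 1 - w ^ 2 = (1 + w) * (1 - w) by ring]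
  simp only [id]
  field_simp
  ring

theorem stripMap_zero : stripMap 0 = 0 := by simp [stripMap]

theorem stripMap_re (w : ℂ) :
    (stripMap w).re = (Real.log ‖1 + w‖ - Real.log ‖1 - w‖) / 2 := by
  rw [stripMap, show (2 : ℂ) = ((2 : ℝ) : ℂ) by norm_num, Complex.div_ofReal_re, Complex.sub_re,
    Complex.log_re, Complex.log_re]

/-- `(stripMap w).re` serves as the coordinate of the projection of `w` to the real diameter,
measured by hyperbolic arc length from `0`. -/
theorem stripMap_ofReal_re {x : ℝ} (h0 : 0 ≤ x) (h1 : x < 1) :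
    (stripMap (x : ℂ)).re = Real.artanh x := by
  rw [stripMap_re, Real.artanh_eq_half_log ⟨by linarith, h1.le⟩,
    Real.log_div (by linarith) (by linarith)]
  norm_cast
  rw [Real.norm_of_nonneg (by linarith), Real.norm_of_nonneg (by linarith)]
  ring

/-- Says that `|stripMap'|` is at most the hyperbolic density; this gives lower bounds for lengths.
-/
theorem one_sub_sq_norm_le (w : ℂ) : 1 - ‖w‖ ^ 2 ≤ ‖1 - w ^ 2‖ := by
  have := norm_sub_norm_le (1 : ℂ) (w ^ 2)
  simpa using this

/-! ### The Riemann mapping theorem -/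

/-- Simple connectedness gives a continuous root; it is holomorphic because squaring has non-zero
derivative away from `0`. -/
theorem exists_differentiableOn_sq_eq {U : Set ℂ} (hUo : IsOpen U) (hUc : IsSimplyConnected U)
    {φ : ℂ → ℂ} (hφ : DifferentiableOn ℂ φ U) (h0 : ∀ z ∈ U, φ z ≠ 0) :
    ∃ h : ℂ → ℂ, DifferentiableOn ℂ h U ∧ ∀ z, h z ^ 2 = φ z := by
  obtain ⟨h, hc, hsq⟩ := Complex.exists_continuousOn_pow_eq hUc hUo hφ.continuousOn
    (by rintro ⟨z, hz, hz0⟩; exact h0 z hz hz0) two_ne_zero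
  refine ⟨h, fun z hz => ?_, hsq⟩
  have hne : h z ≠ 0 := fun hz0 => h0 z hz (by rw [← hsq z, hz0]; ring)
  refine (HasDerivAt.of_comp_left (hc.continuousAt (hUo.mem_nhds hz)) (hasDerivAt_pow 2 (h z))
    (hφ.differentiableAt (hUo.mem_nhds hz)).hasDerivAt ?_
    (Eventually.of_forall hsq)).differentiableAt.differentiableWithinAt
  simpa using hne

/-- A proper simply connected domain embeds holomorphically into the unit disc. -/
theorem exists_injOn_mapsTo_ball {U : Set ℂ} (hUo : IsOpen U) (hUc : IsSimplyConnected U)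
    (hU : U ≠ univ) : ∃ f : ℂ → ℂ, DifferentiableOn ℂ f U ∧ InjOn f U ∧
      MapsTo f U (Metric.ball 0 1) := by
  obtain ⟨a, ha⟩ := (ne_univ_iff_exists_notMem U).1 hU
  obtain ⟨h, hd, hsq⟩ := exists_differentiableOn_sq_eq hUo hUc (φ := fun z => z - a)
    (by fun_prop) fun z hz h0 => ha (by rwa [← sub_eq_zero.1 h0])
  have hne : ∀ z ∈ U, h z ≠ 0 := fun z hz h0 => ha (by
    have := hsq z
    rw [h0] at this
    rwa [show a = z by linear_combination this])
  have hinj : ∀ z w, h z ^ 2 = h w ^ 2 → z = w := fun z w hzw => by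
    rw [hsq, hsq] at hzw
    linear_combination hzw
  obtain ⟨x, hx⟩ := hUc.nonempty
  have himg : h '' U ∈ 𝓝 (h x) :=
    nhds_le_map_nhds_of_injOn hUo hd (fun z _ w _ hzw => hinj z w (by rw [hzw])) hx
      (image_mem_map (hUo.mem_nhds hx))
  obtain ⟨ε, hε, hball⟩ := Metric.mem_nhds_iff.1 himg
  -- A root of `z - a` never takes both a value and its negative. Since `h` covers a disc about `h
  -- x`, it omits the opposite disc about `-h x`.
  have hfar : ∀ z ∈ U, ε ≤ ‖h z + h x‖ := by
    intro z hz
    by_contra! hlt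
    obtain ⟨w, hw, hwz⟩ := hball (show -h z ∈ Metric.ball (h x) ε by
      rw [mem_ball_iff_norm, show -h z - h x = -(h z + h x) by ring, norm_neg]
      exact hlt)
    obtain rfl := hinj w z (by rw [hwz]; ring)
    exact hne w hw (by linear_combination hwz / 2)
  have hpos : ∀ z ∈ U, h z + h x ≠ 0 := fun z hz => norm_pos_iff.1 (hε.trans_le (hfar z hz))
  refine ⟨fun z => (ε / 2 : ℝ) / (h z + h x), ?_, ?_, ?_⟩
  · exact (differentiableOn_const _).div (hd.add_const _) hpos
  · intro z hz w hw hzw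
    have hε2 : ((ε / 2 : ℝ) : ℂ) ≠ 0 := Complex.ofReal_ne_zero.2 (by positivity)
    simp only [div_eq_mul_inv] at hzw
    have h1 := inv_injective (mul_left_cancel₀ hε2 hzw)
    exact hinj z w (by rw [add_right_cancel h1])
  · intro z hz
    rw [mem_ball_zero_iff, norm_div, Complex.norm_real, Real.norm_of_nonneg (by positivity),
      div_lt_one (hε.trans_le (hfar z hz))]
    linarith [hfar z hz]

/-- A uniformly bounded sequence of holomorphic functions converges locally uniformly along every
ultrafilter. -/
theorem exists_tendstoLocallyUniformlyOn {U : Set ℂ} (hUo : IsOpen U) {F : ℕ → ℂ → ℂ}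
    (hF : ∀ n, DifferentiableOn ℂ (F n) U) (hb : ∀ n, MapsTo (F n) U (Metric.ball 0 1))
    (𝒰 : Ultrafilter ℕ) : ∃ f : ℂ → ℂ, TendstoLocallyUniformlyOn F f 𝒰 U := by
  -- Compactness of the closed disc gives pointwise limits along the ultrafilter; no subsequence is
  -- extracted.
  have hlim : ∀ z, ∃ y, z ∈ U → Tendsto (fun n => F n z) 𝒰 (𝓝 y) := by
    intro z
    by_cases hz : z ∈ U
    · obtain ⟨y, -, hy⟩ := (isCompact_closedBall (0 : ℂ) 1).ultrafilter_le_nhds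
        (𝒰.map fun n => F n z) (by
          rw [Ultrafilter.coe_map, le_principal_iff, mem_map]
          exact Eventually.of_forall fun n => Metric.ball_subset_closedBall (hb n hz))
      exact ⟨y, fun _ => hy⟩
    · exact ⟨0, fun h => absurd h hz⟩
  choose f hf using hlim
  refine ⟨f, Metric.tendstoLocallyUniformlyOn_iff.2 fun ε hε x hx => ?_⟩
  obtain ⟨r, hr, hball⟩ := Metric.isOpen_iff.1 hUo x hx
  -- Schwarz, with values in a disc of radius `2` about `F n x`: a Lipschitz bound uniform in `n`,
  -- which makes the convergence locally uniform.
  have hlip : ∀ n, ∀ y ∈ Metric.ball x r, dist (F n y) (F n x) ≤ 2 / r * dist y x := fun n y hy =>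
    Complex.dist_le_div_mul_dist_of_mapsTo_ball ((hF n).mono hball) (fun w hw => by
      have h1 := hb n (hball hw)
      have h2 := hb n hx
      rw [mem_ball_zero_iff] at h1 h2
      rw [mem_closedBall_iff_norm]
      linarith [norm_sub_le (F n w) (F n x)]) hy
  have hlip' : ∀ y ∈ Metric.ball x r, dist (f y) (f x) ≤ 2 / r * dist y x := fun y hy =>
    le_of_tendsto ((hf y (hball hy)).dist (hf x hx)) (Eventually.of_forall fun n => hlip n y hy)
  set δ := min r (r * ε / 6)
  have hδ : 0 < δ := by positivity
  refine ⟨Metric.ball x δ, nhdsWithin_le_nhds (Metric.ball_mem_nhds x hδ), ?_⟩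
  filter_upwards [Metric.tendsto_nhds.1 (hf x hx) (ε / 3) (by positivity)] with n hn y hy
  have hyr : y ∈ Metric.ball x r := Metric.ball_subset_ball (min_le_left _ _) hy
  have hyd : 2 / r * dist y x < ε / 3 := by
    have h1 : dist y x < r * ε / 6 := lt_of_lt_of_le hy (min_le_right _ _)
    rw [div_mul_eq_mul_div, div_lt_iff₀ hr]
    linarith
  have h1 := hlip n y hyr
  have h2 := hlip' y hyr
  have h3 := dist_triangle4 (f y) (f x) (F n x) (F n y)
  rw [dist_comm (f x) (F n x), dist_comm (F n x) (F n y)] at h3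
  linarith

/-- Hurwitz: a non-constant locally uniform limit of injective holomorphic functions is
injective. -/
theorem injOn_of_tendstoLocallyUniformlyOn {U : Set ℂ} (hUo : IsOpen U) (hUc : IsPreconnected U)
    {ι : Type*} {l : Filter ι} [l.NeBot] {F : ι → ℂ → ℂ} {f : ℂ → ℂ}
    (hlim : TendstoLocallyUniformlyOn F f l U) (hF : ∀ n, DifferentiableOn ℂ (F n) U)
    (hinj : ∀ n, InjOn (F n) U) {z₀ : ℂ} (hz₀ : z₀ ∈ U) (hd : deriv f z₀ ≠ 0) : InjOn f U := by
  have hf : DifferentiableOn ℂ f U := hlim.differentiableOn (Eventually.of_forall hF) hUo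
  intro a ha b hb hab
  by_contra hne
  -- By the identity theorem `f` is not constant near `b`, as `f' z₀ ≠ 0`.
  have hnc : ∀ᶠ z in 𝓝[≠] b, f z ≠ f b := by
    refine ((hf.analyticAt (hUo.mem_nhds hb)).eventually_eq_or_eventually_ne
      analyticAt_const).resolve_left fun hc => hd ?_
    have h1 := (hf.analyticOnNhd hUo).eqOn_of_preconnected_of_eventuallyEq
      (analyticOnNhd_const (v := f b)) hUc hb hc
    have h2 : f =ᶠ[𝓝 z₀] fun _ => f b := by
      filter_upwards [hUo.mem_nhds hz₀] with z hz
      exact h1 hz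
    rw [h2.deriv_eq, deriv_const]
  obtain ⟨r, hr, hball⟩ := Metric.eventually_nhds_iff_ball.1
    ((eventually_nhdsWithin_iff.1 hnc).and
      ((hUo.eventually_mem hb).and (isOpen_ne.eventually_mem (Ne.symm hne))))
  have hs0 : 0 < r / 2 := by positivity
  have hcb : Metric.closedBall b (r / 2) ⊆ Metric.ball b r :=
    Metric.closedBall_subset_ball (by linarith)
  have hcU : Metric.closedBall b (r / 2) ⊆ U := fun z hz => (hball z (hcb hz)).2.1
  obtain ⟨ε, hε, hεs⟩ : ∃ ε > 0, ∀ z ∈ Metric.sphere b (r / 2), ε ≤ ‖f z - f b‖ := by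
    have hsub : Metric.sphere b (r / 2) ⊆ U := Metric.sphere_subset_closedBall.trans hcU
    obtain ⟨x, hx, hmin⟩ := (isCompact_sphere b (r / 2)).exists_isMinOn
      (NormedSpace.sphere_nonempty.2 hs0.le)
      (((hf.continuousOn.mono hsub).sub continuousOn_const).norm (f := fun z => f z - f b))
    refine ⟨_, norm_pos_iff.2 (sub_ne_zero.2 ?_), fun z hz => hmin hz⟩
    refine (hball x (hcb (Metric.sphere_subset_closedBall hx))).1 ?_
    rintro rfl
    simp [hs0.ne] at hx
  have hunif := Metric.tendstoUniformlyOn_iff.1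
    ((tendstoLocallyUniformlyOn_iff_forall_isCompact hUo).1 hlim _ hcU
      (isCompact_closedBall b (r / 2))) (ε / 8) (by positivity)
  have ha' := Metric.tendsto_nhds.1 (hlim.tendsto_at ha) (ε / 8) (by positivity)
  obtain ⟨n, hn, hna⟩ := (hunif.and ha').exists
  have hnb := hn b (Metric.mem_closedBall_self hs0.le)
  -- Quantitative open mapping: errors below `ε / 8` leave `‖F n z - F n b‖ ≥ ε / 2` on the circle,
  -- so `F n` covers the disc of radius `ε / 4` about `F n b`. That disc contains `F n a`, while `a`
  -- lies outside the ball around `b`.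
  have himg := DiffContOnCl.ball_subset_image_closedBall (f := F n) (z₀ := b) (r := r / 2)
    (ε := ε / 2) ((hF n).diffContOnCl_ball hcU) hs0 (fun z hz => by
      have h1 := hn z (Metric.sphere_subset_closedBall hz)
      have h2 := hεs z hz
      rw [dist_eq_norm] at h1 hnb
      have h3 : ‖f z - f b‖ ≤ ‖f z - F n z‖ + ‖F n z - F n b‖ + ‖f b - F n b‖ := by
        rw [show f z - f b = (f z - F n z) + (F n z - F n b) - (f b - F n b) by ring]
        exact (norm_sub_le _ _).trans (add_le_add_left (norm_add_le _ _) _)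
      linarith) (by
      have := not_eventually_const_of_injOn hUo (hinj n) hb
      rwa [not_eventually] at this)
  obtain ⟨w, hw, hwa⟩ := himg (show F n a ∈ Metric.ball (F n b) (ε / 2 / 2) by
    have h1 := dist_triangle4 (F n a) (f a) (f b) (F n b)
    rw [hab, dist_self] at h1
    rw [hab] at hna
    rw [Metric.mem_ball]
    linarith)
  have := hinj n (hcU hw) ha hwa
  exact (hball w (hcb hw)).2.2 this

/-- The holomorphic embeddings of `U` into the unit disc that vanish at `z₀`. -/
structure IsDiscEmbedding (f : ℂ → ℂ) (U : Set ℂ) (z₀ : ℂ) : Prop where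
  differentiableOn : DifferentiableOn ℂ f U
  injOn : InjOn f U
  mapsTo : MapsTo f U (Metric.ball 0 1)
  map_zero : f z₀ = 0

theorem isDiscEmbedding_mob_comp {f : ℂ → ℂ} {U : Set ℂ} {z₀ : ℂ} (hz₀ : z₀ ∈ U)
    (hd : DifferentiableOn ℂ f U) (hi : InjOn f U) (hm : MapsTo f U (Metric.ball 0 1)) :
    IsDiscEmbedding (fun z => mob (-f z₀) (f z)) U z₀ := by
  have hlt : ∀ z ∈ U, ‖f z‖ < 1 := fun z hz => by simpa using hm hz
  have ha : ‖-f z₀‖ < 1 := by simpa using hlt z₀ hz₀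
  refine ⟨fun z hz => ?_, fun z hz w hw hzw => hi hz hw ?_, fun z hz => ?_, by simp [mob]⟩
  · exact (hasDerivAt_mob ha (hlt z hz).le).differentiableAt.comp_differentiableWithinAt z (hd z hz)
  · rw [← mob_neg_mob ha (hlt z hz).le, ← mob_neg_mob ha (hlt w hw).le]
    exact congrArg _ hzw
  · simpa using norm_mob_lt_one ha (hlt z hz)

theorem norm_deriv_mob_comp {f : ℂ → ℂ} {z₀ : ℂ} (hd : DifferentiableAt ℂ f z₀) (h1 : ‖f z₀‖ < 1) :
    ‖deriv (fun z => mob (-f z₀) (f z)) z₀‖ = ‖deriv f z₀‖ / (1 - ‖f z₀‖ ^ 2) := by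
  have ha : ‖-f z₀‖ < 1 := by simpa using h1
  have h := (hasDerivAt_mob ha h1.le).comp z₀ hd.hasDerivAt
  have h2 := one_sub_sq_pos (norm_nonneg _) h1
  rw [show deriv (fun z => mob (-f z₀) (f z)) z₀ = _ from h.deriv, norm_mul, norm_div, norm_pow,
    norm_one_sub_conj_mul_self ha, map_neg, neg_mul, ← sub_eq_add_neg,
    norm_one_sub_conj_mul_self h1, norm_neg]
  field_simp

/-- An embedding into the disc that is not onto does not have maximal derivative. -/
theorem IsDiscEmbedding.exists_norm_deriv_lt {U : Set ℂ} (hUo : IsOpen U)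
    (hUc : IsSimplyConnected U) {z₀ : ℂ} (hz₀ : z₀ ∈ U) {f : ℂ → ℂ} (hf : IsDiscEmbedding f U z₀)
    {a : ℂ} (ha : ‖a‖ < 1) (haU : a ∉ f '' U) :
    ∃ k, IsDiscEmbedding k U z₀ ∧ ‖deriv f z₀‖ < ‖deriv k z₀‖ := by
  have ha' : ‖-a‖ < 1 := by simpa using ha
  have hlt : ∀ z ∈ U, ‖f z‖ < 1 := fun z hz => by simpa using hf.mapsTo hz
  have ha0 : a ≠ 0 := fun h => haU ⟨z₀, hz₀, by rw [hf.map_zero, h]⟩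
  -- Koebe's trick: move the omitted value `a` to `0`, take a square root, then renormalise at `z₀`.
  obtain ⟨h, hd, hsq⟩ := exists_differentiableOn_sq_eq hUo hUc (φ := fun z => mob (-a) (f z))
    (fun z hz => (hasDerivAt_mob ha' (hlt z hz).le).differentiableAt.comp_differentiableWithinAt z
      (hf.differentiableOn z hz)) (fun z hz h0 => haU ⟨z, hz, by
        have := mob_mob_neg ha (hlt z hz).le
        rw [h0, mob_zero] at this
        exact this.symm⟩)
  have hinj : InjOn h U := fun z hz w hw hzw => hf.injOn hz hw (by
    have : mob (-a) (f z) = mob (-a) (f w) := by rw [← hsq, ← hsq, hzw]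
    rw [← mob_mob_neg ha (hlt z hz).le, this, mob_mob_neg ha (hlt w hw).le])
  have hm : MapsTo h U (Metric.ball 0 1) := fun z hz => by
    have h1 := norm_mob_lt_one ha' (hlt z hz)
    rw [← hsq, norm_pow] at h1
    rw [mem_ball_zero_iff]
    nlinarith [norm_nonneg (h z)]
  have hh1 : ‖h z₀‖ < 1 := by simpa using hm hz₀
  have hd0 := hd.differentiableAt (hUo.mem_nhds hz₀)
  refine ⟨_, isDiscEmbedding_mob_comp hz₀ hd hinj hm, ?_⟩
  rw [norm_deriv_mob_comp hd0 hh1]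
  have hnorm : ‖h z₀‖ ^ 2 = ‖a‖ := by
    rw [← norm_pow, hsq]
    simp [hf.map_zero, mob]
  have hhpos : 0 < ‖h z₀‖ := by
    have : 0 < ‖a‖ := norm_pos_iff.2 ha0
    rw [← hnorm] at this
    exact (sq_pos_iff.1 this).lt_of_le' (norm_nonneg _)
  have hf0 := hf.differentiableOn.differentiableAt (hUo.mem_nhds hz₀)
  have e1 : HasDerivAt (fun z => h z ^ 2) (2 * h z₀ * deriv h z₀) z₀ := by
    exact (hd0.hasDerivAt.pow 2).congr_deriv (by simp)
  have e2 : HasDerivAt (fun z => h z ^ 2) ((1 - conj a * a) * deriv f z₀) z₀ := by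
    have h1 := hasDerivAt_mob (w := f z₀) ha' (hlt z₀ hz₀).le
    rw [hf.map_zero] at h1
    rw [funext hsq]
    refine (h1.comp_of_eq z₀ hf0.hasDerivAt hf.map_zero.symm).congr_deriv ?_
    simp
  have e3 : 2 * ‖h z₀‖ * ‖deriv h z₀‖ = (1 - ‖a‖ ^ 2) * ‖deriv f z₀‖ := by
    have := congrArg norm (e1.unique e2)
    rwa [norm_mul, norm_mul, norm_mul, norm_one_sub_conj_mul_self ha, Complex.norm_ofNat] at this
  have hfpos := norm_pos_iff.2 (deriv_ne_zero_of_injOn hUo hf.differentiableOn hf.injOn hz₀)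
  rw [lt_div_iff₀ (one_sub_sq_pos (norm_nonneg _) hh1), hnorm]
  rw [← hnorm] at e3 ⊢
  generalize ‖h z₀‖ = x at *
  generalize ‖deriv f z₀‖ = d at *
  have hx2 : 0 < 1 - x ^ 2 := one_sub_sq_pos hhpos.le hh1
  -- With `x ^ 2 = ‖a‖`, the new derivative is `(1 + x ^ 2) / (2 * x)` times the old one, and this
  -- factor exceeds `1`.
  have h5 : 2 * x * (d * (1 - x ^ 2)) < 2 * x * ‖deriv h z₀‖ := by
    rw [e3, show (1 - (x ^ 2) ^ 2) * d = (1 + x ^ 2) * (d * (1 - x ^ 2)) by ring]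
    exact mul_lt_mul_of_pos_right (by nlinarith [sq_pos_of_pos (sub_pos.2 hh1)]) (mul_pos hfpos hx2)
  exact lt_of_mul_lt_mul_left h5 (by positivity)

/-- Among the embeddings into the disc there is one of maximal derivative. -/
theorem exists_isDiscEmbedding_isMax {U : Set ℂ} (hU : IsProperSCDomain U) {z₀ : ℂ}
    (hz₀ : z₀ ∈ U) : ∃ f, IsDiscEmbedding f U z₀ ∧
      ∀ k, IsDiscEmbedding k U z₀ → ‖deriv k z₀‖ ≤ ‖deriv f z₀‖ := by
  obtain ⟨hUo, hUc, hUne⟩ := hU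
  have hconn : IsPreconnected U := hUc.isPathConnected.isConnected.isPreconnected
  set A := {x : ℝ | ∃ k, IsDiscEmbedding k U z₀ ∧ x = ‖deriv k z₀‖}
  obtain ⟨k₀, hk₀⟩ : ∃ k, IsDiscEmbedding k U z₀ :=
    let ⟨_, h1, h2, h3⟩ := exists_injOn_mapsTo_ball hUo hUc hUne
    ⟨_, isDiscEmbedding_mob_comp hz₀ h1 h2 h3⟩
  obtain ⟨r, hr, hball⟩ := Metric.isOpen_iff.1 hUo z₀ hz₀
  have hbdd : BddAbove A := by
    refine ⟨1 / r, ?_⟩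
    rintro x ⟨k, hk, rfl⟩
    refine Complex.norm_deriv_le_div_of_mapsTo_ball (hk.differentiableOn.mono hball)
      (fun w hw => ?_) hr
    rw [hk.map_zero]
    exact Metric.ball_subset_closedBall (hk.mapsTo (hball hw))
  obtain ⟨u, -, hu, huA⟩ := exists_seq_tendsto_sSup (S := A) ⟨_, k₀, hk₀, rfl⟩ hbdd
  choose F hF hFu using huA
  set 𝒰 := hyperfilter ℕ
  have h𝒰 : (𝒰 : Filter ℕ) ≤ atTop := by
    rw [← Nat.cofinite_eq_atTop]; exact hyperfilter_le_cofinite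
  obtain ⟨f, hlim⟩ := exists_tendstoLocallyUniformlyOn hUo (fun n => (hF n).differentiableOn)
    (fun n => (hF n).mapsTo) 𝒰
  have hev : ∀ᶠ n in (𝒰 : Filter ℕ), DifferentiableOn ℂ (F n) U :=
    Eventually.of_forall fun n => (hF n).differentiableOn
  have hd : DifferentiableOn ℂ f U := hlim.differentiableOn hev hUo
  have hS : ‖deriv f z₀‖ = sSup A := by
    refine tendsto_nhds_unique ((hlim.deriv hev hUo).tendsto_at hz₀).norm ?_
    refine (hu.mono_left h𝒰).congr fun n => ?_
    exact hFu n
  have hmax : ∀ k, IsDiscEmbedding k U z₀ → ‖deriv k z₀‖ ≤ ‖deriv f z₀‖ := fun k hk => by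
    rw [hS]; exact le_csSup hbdd ⟨k, hk, rfl⟩
  have hne : deriv f z₀ ≠ 0 := norm_pos_iff.1 (lt_of_lt_of_le (norm_pos_iff.2
    (deriv_ne_zero_of_injOn hUo hk₀.differentiableOn hk₀.injOn hz₀)) (hmax k₀ hk₀))
  have hinj : InjOn f U := injOn_of_tendstoLocallyUniformlyOn hUo hconn hlim
    (fun n => (hF n).differentiableOn) (fun n => (hF n).injOn) hz₀ hne
  have hle : ∀ z ∈ U, f z ∈ Metric.closedBall (0 : ℂ) 1 := fun z hz =>
    Metric.isClosed_closedBall.mem_of_tendsto (hlim.tendsto_at hz)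
      (Eventually.of_forall fun n => Metric.ball_subset_closedBall ((hF n).mapsTo hz))
  refine ⟨f, ⟨hd, hinj, fun z hz => ?_, ?_⟩, hmax⟩
  -- The limit has values in the closed disc; the open mapping theorem moves them to its interior.
  · have h1 : Metric.closedBall (0 : ℂ) 1 ∈ 𝓝 (f z) :=
      mem_of_superset (nhds_le_map_nhds_of_injOn hUo hd hinj hz (image_mem_map (hUo.mem_nhds hz)))
        (image_subset_iff.2 hle)
    rw [← interior_closedBall (0 : ℂ) one_ne_zero]
    exact mem_interior_iff_mem_nhds.2 h1
  · refine tendsto_nhds_unique (hlim.tendsto_at hz₀) ?_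
    simp only [(hF _).map_zero]
    exact tendsto_const_nhds

/-- The **Riemann mapping theorem**. -/
theorem exists_isRiemannMap {U : Set ℂ} (hU : IsProperSCDomain U) : ∃ g, IsRiemannMap g U := by
  obtain ⟨z₀, hz₀⟩ := hU.2.1.nonempty
  obtain ⟨f, hf, hmax⟩ := exists_isDiscEmbedding_isMax hU hz₀
  have hsurj : SurjOn f U (Metric.ball 0 1) := by
    intro a ha
    by_contra hna
    obtain ⟨k, hk, hlt⟩ := hf.exists_norm_deriv_lt hU.1 hU.2.1 hz₀ (by simpa using ha) hna
    exact absurd (hmax k hk) (not_le.2 hlt)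
  have hbij : BijOn f U (Metric.ball 0 1) := ⟨hf.mapsTo, hf.injOn, hsurj⟩
  refine ⟨Function.invFunOn f U, fun w hw => ?_, ?_⟩
  · obtain ⟨z, hz, rfl⟩ := hsurj hw
    exact (hasDerivAt_invFunOn hU.1 hf.differentiableOn hf.injOn
      hz).differentiableAt.differentiableWithinAt
  · exact hbij.symm hbij.invOn_invFunOn.symm

/-! ### Unimodular factors and the hyperbolic tangent. -/

theorem exists_unit_mul_eq_norm (w : ℂ) : ∃ e : ℂ, ‖e‖ = 1 ∧ e * w = ‖w‖ := by
  rcases eq_or_ne w 0 with rfl | hw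
  · exact ⟨1, by simp⟩
  · have hn : (‖w‖ : ℂ) ≠ 0 := by simpa using hw
    refine ⟨‖w‖ / w, ?_, by field_simp⟩
    simp [hw]

theorem norm_unit_mul_tanh_lt {e : ℂ} (he : ‖e‖ = 1) (x : ℝ) : ‖e * (Real.tanh x : ℂ)‖ < 1 := by
  rw [norm_mul, he, one_mul, Complex.norm_real, Real.norm_eq_abs, abs_lt]
  exact ⟨Real.neg_one_lt_tanh x, Real.tanh_lt_one x⟩

theorem one_sub_tanh_sq (x : ℝ) : 1 - Real.tanh x ^ 2 = (Real.cosh x ^ 2)⁻¹ := by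
  have h := Real.cosh_pos x
  have h2 := Real.cosh_sq x
  rw [Real.tanh_eq_sinh_div_cosh]
  field_simp
  linarith

theorem hasDerivAt_tanh (x : ℝ) : HasDerivAt Real.tanh ((Real.cosh x ^ 2)⁻¹) x := by
  have h := Real.cosh_pos x
  have h2 := Real.cosh_sq x
  have := (Real.hasDerivAt_sinh x).div (Real.hasDerivAt_cosh x) h.ne'
  refine (this.congr_of_eventuallyEq
    (Eventually.of_forall Real.tanh_eq_sinh_div_cosh)).congr_deriv ?_
  field_simp
  linarith

theorem tanh_lt_tanh {x y : ℝ} (h : x < y) : Real.tanh x < Real.tanh y := by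
  rwa [← Real.artanh_lt_artanh_iff ⟨Real.neg_one_lt_tanh _, Real.tanh_lt_one _⟩
    ⟨Real.neg_one_lt_tanh _, Real.tanh_lt_one _⟩, Real.artanh_tanh, Real.artanh_tanh]

theorem tanh_pos {R : ℝ} (hR : 0 < R) : 0 < Real.tanh R := by
  rw [Real.tanh_eq_sinh_div_cosh]
  exact div_pos (Real.sinh_pos_iff.2 hR) (Real.cosh_pos R)

/-! ### Lengths of piecewise smooth curves -/

theorem IsPiecewiseC1.of_contDiffOn {γ : ℝ → ℂ} {a b : ℝ} (hab : a ≤ b)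
    (h : ContDiffOn ℝ 1 γ (Icc a b)) : IsPiecewiseC1 γ a b := by
  refine ⟨h.continuousOn, 1, fun i => if i = 0 then a else b, ?_, by simp, by simp, ?_⟩
  · refine monotone_nat_of_le_succ fun n => ?_
    rcases n with _ | n <;> simp [hab]
  · intro i hi
    obtain rfl : i = 0 := by omega
    simpa using h

/-- At the end points `deriv` need not equal the one-sided derivative, but they form a null set, so
the continuous `derivWithin` may replace it. -/
theorem intervalIntegrable_deriv_of_contDiffOn {γ : ℝ → ℂ} {a b : ℝ} (hab : a ≤ b)
    (h : ContDiffOn ℝ 1 γ (Icc a b)) : IntervalIntegrable (deriv γ) volume a b := by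
  rcases hab.eq_or_lt with rfl | hlt
  · exact IntervalIntegrable.refl
  have hc : ContinuousOn (derivWithin γ (Icc a b)) (Icc a b) :=
    h.continuousOn_derivWithin (uniqueDiffOn_Icc hlt) le_rfl
  have hi : IntervalIntegrable (derivWithin γ (Icc a b)) volume a b :=
    ContinuousOn.intervalIntegrable (by rwa [uIcc_of_le hab])
  rw [intervalIntegrable_iff_integrableOn_Ioo_of_le hab] at hi ⊢
  refine hi.congr_fun (fun t ht => ?_) measurableSet_Ioo
  exact derivWithin_of_mem_nhds (Icc_mem_nhds ht.1 ht.2)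

theorem IsPiecewiseC1.intervalIntegrable_deriv {γ : ℝ → ℂ} {a b : ℝ} (h : IsPiecewiseC1 γ a b) :
    IntervalIntegrable (deriv γ) volume a b := by
  obtain ⟨-, n, t, ht, rfl, rfl, hi⟩ := h
  exact IntervalIntegrable.trans_iterate fun i hin =>
    intervalIntegrable_deriv_of_contDiffOn (ht i.le_succ) (hi i hin)

theorem norm_sub_le_integral_of_contDiffOn {γ : ℝ → ℂ} {a b : ℝ} (hab : a ≤ b)
    (h : ContDiffOn ℝ 1 γ (Icc a b)) {V : Set ℂ} (hV : IsOpen V) (hγ : MapsTo γ (Icc a b) V)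
    {F : ℂ → ℂ} (hF : DifferentiableOn ℂ F V) {m : ℝ → ℝ} (hm : IntervalIntegrable m volume a b)
    (hle : ∀ u ∈ Ioo a b, ‖deriv F (γ u)‖ * ‖deriv γ u‖ ≤ m u) :
    ‖F (γ b) - F (γ a)‖ ≤ ∫ u in a..b, m u := by
  have hd : ∀ u ∈ Ioo a b, HasDerivAt (F ∘ γ) (deriv F (γ u) * deriv γ u) u := fun u hu => by
    have h1 : DifferentiableAt ℝ γ u :=
      (h.differentiableOn one_ne_zero).differentiableAt (Icc_mem_nhds hu.1 hu.2)
    have h2 := (hF.differentiableAt (hV.mem_nhds (hγ (Ioo_subset_Icc_self hu)))).hasDerivAt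
    exact h2.comp_of_eq u h1.hasDerivAt rfl
  refine norm_sub_le_integral_of_norm_deriv_le_of_le (f := F ∘ γ) hab
    (hF.continuousOn.comp h.continuousOn hγ)
    (fun u hu => (hd u hu).differentiableAt.differentiableWithinAt)
    (Eventually.of_forall fun u hu => ?_) hm
  rw [(hd u hu).deriv, norm_mul]
  exact hle u hu

theorem IsPiecewiseC1.norm_sub_le_integral {γ : ℝ → ℂ} {a b : ℝ} (h : IsPiecewiseC1 γ a b)
    {V : Set ℂ} (hV : IsOpen V) (hγ : MapsTo γ (Icc a b) V)
    {F : ℂ → ℂ} (hF : DifferentiableOn ℂ F V) {m : ℝ → ℝ} (hm : IntervalIntegrable m volume a b)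
    (hle : ∀ u ∈ Ioo a b, ‖deriv F (γ u)‖ * ‖deriv γ u‖ ≤ m u) :
    ‖F (γ b) - F (γ a)‖ ≤ ∫ u in a..b, m u := by
  obtain ⟨-, n, t, ht, rfl, rfl, hi⟩ := h
  have hsub : ∀ i < n, Icc (t i) (t (i + 1)) ⊆ Icc (t 0) (t n) := fun i hin =>
    Icc_subset_Icc (ht (Nat.zero_le i)) (ht hin)
  have hmi : ∀ i < n, IntervalIntegrable m volume (t i) (t (i + 1)) := fun i hin =>
    hm.mono_set (by
      rw [uIcc_of_le (ht i.le_succ), uIcc_of_le (ht (Nat.zero_le n))]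
      exact hsub i hin)
  rw [← intervalIntegral.sum_integral_adjacent_intervals hmi,
    ← Finset.sum_range_sub (fun i => F (γ (t i)))]
  refine (norm_sum_le _ _).trans (Finset.sum_le_sum fun i hin => ?_)
  rw [Finset.mem_range] at hin
  exact norm_sub_le_integral_of_contDiffOn (ht i.le_succ) (hi i hin) hV
    (hγ.mono_left (hsub i hin)) hF (hmi i hin)
    fun u hu => hle u (Ioo_subset_Ioo (ht (Nat.zero_le i)) (ht hin) hu)

theorem hypLength_nonneg (U : Set ℂ) (γ : ℝ → ℂ) {s t : ℝ} (hst : s ≤ t) :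
    0 ≤ hypLength U γ s t :=
  intervalIntegral.integral_nonneg hst fun _ _ => kappa_nonneg _ _ _

theorem hypDist_bddBelow (U : Set ℂ) (z w : ℂ) :
    BddBelow {L : ℝ | ∃ γ : ℝ → ℂ, IsPiecewiseC1 γ 0 1 ∧ MapsTo γ (Icc 0 1) U ∧
      γ 0 = z ∧ γ 1 = w ∧ L = hypLength U γ 0 1} :=
  ⟨0, by rintro L ⟨γ, -, -, -, -, rfl⟩; exact hypLength_nonneg U γ zero_le_one⟩

theorem hypDist_nonneg (U : Set ℂ) (z w : ℂ) : 0 ≤ hypDist U z w :=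
  Real.sInf_nonneg (by rintro L ⟨γ, -, -, -, -, rfl⟩; exact hypLength_nonneg U γ zero_le_one)

namespace IsRiemannMap

variable {f : ℂ → ℂ} {U : Set ℂ}

theorem kappa_eq (hf : IsRiemannMap f U) {w : ℂ} (hw : w ∈ U) (v : ℂ) :
    kappa U w v = (‖deriv f (rinv f w)‖ * (1 - ‖rinv f w‖ ^ 2))⁻¹ * ‖v‖ := by
  have := hf.kappa_apply (hf.norm_rinv_lt hw) v
  rw [hf.apply_rinv hw] at this
  rw [this]
  ring

theorem continuousOn_rinv (hf : IsRiemannMap f U) : ContinuousOn (rinv f) U := fun _ hw =>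
  (hf.hasDerivAt_rinv hw).continuousAt.continuousWithinAt

theorem differentiableOn_rinv (hf : IsRiemannMap f U) : DifferentiableOn ℂ (rinv f) U :=
  fun _ hw => (hf.hasDerivAt_rinv hw).differentiableAt.differentiableWithinAt

theorem continuousOn_density (hf : IsRiemannMap f U) :
    ContinuousOn (fun w => (‖deriv f (rinv f w)‖ * (1 - ‖rinv f w‖ ^ 2))⁻¹) U := by
  have hd : ContinuousOn (fun w => deriv f (rinv f w)) U := by
    refine (hf.1.deriv Metric.isOpen_ball).continuousOn.comp hf.continuousOn_rinv fun w hw => ?_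
    simpa using hf.norm_rinv_lt hw
  have h := hf.continuousOn_rinv
  refine ContinuousOn.inv₀ (by fun_prop) fun w hw => ?_
  exact mul_ne_zero (norm_ne_zero_iff.2 (hf.deriv_ne_zero (hf.norm_rinv_lt hw)))
    (one_sub_sq_pos (norm_nonneg _) (hf.norm_rinv_lt hw)).ne'

theorem intervalIntegrable_kappa (hf : IsRiemannMap f U) {γ : ℝ → ℂ} {a b : ℝ} (hab : a ≤ b)
    (hγ : IsPiecewiseC1 γ a b) (hm : MapsTo γ (Icc a b) U) :
    IntervalIntegrable (fun u => kappa U (γ u) (deriv γ u)) volume a b := by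
  have h1 : ContinuousOn
      (fun u => (‖deriv f (rinv f (γ u))‖ * (1 - ‖rinv f (γ u)‖ ^ 2))⁻¹) (uIcc a b) := by
    rw [uIcc_of_le hab]
    exact hf.continuousOn_density.comp hγ.1 hm
  refine (hγ.intervalIntegrable_deriv.norm.continuousOn_mul h1).congr fun u hu => ?_
  rw [uIoc_of_le hab] at hu
  exact (hf.kappa_eq (hm (Ioc_subset_Icc_self hu)) _).symm

/-- The strip coordinate of a domain along the diameter of direction `e`. -/
theorem hasDerivAt_stripMap_rinv (hf : IsRiemannMap f U) {e : ℂ} (he : ‖e‖ = 1) {w : ℂ}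
    (hw : w ∈ U) : HasDerivAt (fun w => stripMap (e * rinv f w))
      ((1 - (e * rinv f w) ^ 2)⁻¹ * (e * (deriv f (rinv f w))⁻¹)) w := by
  have h1 := hasDerivAt_stripMap (w := e * rinv f w) (by simpa [he] using hf.norm_rinv_lt hw)
  exact h1.comp w ((hf.hasDerivAt_rinv hw).const_mul e)

theorem norm_deriv_stripMap_rinv_le (hf : IsRiemannMap f U) {e : ℂ} (he : ‖e‖ = 1) {w : ℂ}
    (hw : w ∈ U) (v : ℂ) :
    ‖deriv (fun w => stripMap (e * rinv f w)) w‖ * ‖v‖ ≤ kappa U w v := by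
  have hn := hf.norm_rinv_lt hw
  have h1 := one_sub_sq_pos (norm_nonneg _) hn
  have h2 : 1 - ‖rinv f w‖ ^ 2 ≤ ‖1 - (e * rinv f w) ^ 2‖ := by
    simpa [he] using one_sub_sq_norm_le (e * rinv f w)
  have h3 := norm_pos_iff.2 (hf.deriv_ne_zero hn)
  rw [(hf.hasDerivAt_stripMap_rinv he hw).deriv, hf.kappa_eq hw, norm_mul, norm_inv, norm_mul, he,
    one_mul, norm_inv, ← mul_inv, mul_comm ‖1 - _‖]
  gcongr

/-- Any upper bound for the hyperbolic speed of a curve bounds the hyperbolic distance of its end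
points. -/
theorem artanh_le_integral (hf : IsRiemannMap f U) {γ : ℝ → ℂ} {a b : ℝ}
    (hγ : IsPiecewiseC1 γ a b) (hm : MapsTo γ (Icc a b) U) {w : ℂ} (hw : ‖w‖ < 1)
    (h0 : γ a = f 0) (h1 : γ b = f w) {m : ℝ → ℝ} (hmi : IntervalIntegrable m volume a b)
    (hle : ∀ u ∈ Ioo a b, kappa U (γ u) (deriv γ u) ≤ m u) :
    Real.artanh ‖w‖ ≤ ∫ u in a..b, m u := by
  -- After rotation by `e` the end point is `‖w‖`, whose strip coordinate is `artanh ‖w‖`; the strip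
  -- map does not increase length.
  obtain ⟨e, he, hew⟩ := exists_unit_mul_eq_norm w
  have h := hγ.norm_sub_le_integral hf.isOpen hm (F := fun w => stripMap (e * rinv f w))
    (fun w hw => (hf.hasDerivAt_stripMap_rinv he hw).differentiableAt.differentiableWithinAt) hmi
    fun u hu => (hf.norm_deriv_stripMap_rinv_le he (hm (Ioo_subset_Icc_self hu)) _).trans (hle u hu)
  refine le_trans ?_ h
  simp only [h0, h1, hf.rinv_apply hw, hf.rinv_apply (z := 0) (by simp), hew, mul_zero,
    stripMap_zero, sub_zero]
  rw [← stripMap_ofReal_re (norm_nonneg w) hw]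
  exact Complex.re_le_norm _

theorem hasDerivAt_ray (hf : IsRiemannMap f U) {e : ℂ} (he : ‖e‖ = 1) (r t : ℝ) :
    HasDerivAt (fun t : ℝ => f (e * (Real.tanh (r * t) : ℂ)))
      (deriv f (e * (Real.tanh (r * t) : ℂ)) *
        (e * (((Real.cosh (r * t) ^ 2)⁻¹ * r : ℝ) : ℂ))) t := by
  have h1 : HasDerivAt (fun t : ℝ => Real.tanh (r * t)) ((Real.cosh (r * t) ^ 2)⁻¹ * r) t :=
    ((hasDerivAt_tanh (r * t)).comp t ((hasDerivAt_id t).const_mul r)).congr_deriv (by simp)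
  exact (hf.differentiableAt (norm_unit_mul_tanh_lt he (r * t))).hasDerivAt.comp_of_eq t
    (h1.ofReal_comp.const_mul e) rfl

theorem contDiff_ray (hf : IsRiemannMap f U) {e : ℂ} (he : ‖e‖ = 1) (r : ℝ) :
    ContDiff ℝ 1 (fun t : ℝ => f (e * (Real.tanh (r * t) : ℂ))) := by
  rw [contDiff_one_iff_deriv]
  refine ⟨fun t => (hf.hasDerivAt_ray he r t).differentiableAt, ?_⟩
  rw [funext fun t => (hf.hasDerivAt_ray he r t).deriv]
  have ht : Continuous Real.tanh :=
    continuous_iff_continuousAt.2 fun x => (hasDerivAt_tanh x).continuousAt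
  have h1 : Continuous fun t : ℝ => deriv f (e * (Real.tanh (r * t) : ℂ)) := by
    refine (hf.1.deriv Metric.isOpen_ball).continuousOn.comp_continuous (by fun_prop) fun t => ?_
    simpa only [mem_ball_zero_iff] using norm_unit_mul_tanh_lt he (r * t)
  refine h1.mul (continuous_const.mul (Complex.continuous_ofReal.comp ?_))
  refine Continuous.mul (Continuous.inv₀ (by fun_prop) fun t => ?_) continuous_const
  exact (pow_pos (Real.cosh_pos _) 2).ne'

/-- The derivative of `tanh` equals `1 - tanh ^ 2`, which cancels the density and leaves constant
speed `r`. -/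
theorem kappa_ray (hf : IsRiemannMap f U) {e : ℂ} (he : ‖e‖ = 1) {r : ℝ} (hr : 0 ≤ r) (t : ℝ) :
    kappa U (f (e * (Real.tanh (r * t) : ℂ)))
      (deriv (fun t : ℝ => f (e * (Real.tanh (r * t) : ℂ))) t) = r := by
  have h := hf.deriv_ne_zero (norm_unit_mul_tanh_lt he (r * t))
  have hc := Real.cosh_pos (r * t)
  rw [hf.kappa_apply (norm_unit_mul_tanh_lt he _), (hf.hasDerivAt_ray he r t).deriv, norm_mul,
    norm_mul, norm_mul, he, one_mul, one_mul, Complex.norm_real, Complex.norm_real,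
    Real.norm_eq_abs (Real.tanh _), sq_abs, one_sub_tanh_sq, Real.norm_of_nonneg (by positivity)]
  have := norm_pos_iff.2 h
  generalize ‖deriv f (e * (Real.tanh (r * t) : ℂ))‖ = x at *
  field_simp

theorem hypLength_ray (hf : IsRiemannMap f U) {e : ℂ} (he : ‖e‖ = 1) {r : ℝ} (hr : 0 ≤ r)
    (s t : ℝ) : hypLength U (fun t : ℝ => f (e * (Real.tanh (r * t) : ℂ))) s t = (t - s) * r := by
  simp only [hypLength, hf.kappa_ray he hr, intervalIntegral.integral_const, smul_eq_mul]

/-- The radius to `w`, run at speed `artanh ‖w‖`, attains the lower bound of `artanh_le_integral`.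
-/
theorem hypDist_zero (hf : IsRiemannMap f U) {w : ℂ} (hw : ‖w‖ < 1) :
    hypDist U (f 0) (f w) = Real.artanh ‖w‖ := by
  obtain ⟨e, he, hew⟩ := exists_unit_mul_eq_norm w
  have hmem : Real.artanh ‖w‖ ∈ {L : ℝ | ∃ γ : ℝ → ℂ, IsPiecewiseC1 γ 0 1 ∧
      MapsTo γ (Icc 0 1) U ∧ γ 0 = f 0 ∧ γ 1 = f w ∧ L = hypLength U γ 0 1} := by
    have hr : 0 ≤ Real.artanh ‖w‖ := Real.artanh_nonneg (norm_nonneg w)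
    have he' : ‖e⁻¹‖ = 1 := by simp [he]
    have he0 : e ≠ 0 := by rintro rfl; simp at he
    refine ⟨fun t : ℝ => f (e⁻¹ * (Real.tanh (Real.artanh ‖w‖ * t) : ℂ)),
      .of_contDiffOn zero_le_one (hf.contDiff_ray he' _).contDiffOn,
      fun t _ => hf.mem (norm_unit_mul_tanh_lt he' _), by simp, ?_, ?_⟩
    · simp only [mul_one]
      rw [Real.tanh_artanh ⟨by linarith [norm_nonneg w], hw⟩, ← hew, inv_mul_cancel_left₀ he0]
    · rw [hf.hypLength_ray he' hr]; simp
  refine le_antisymm (csInf_le (hypDist_bddBelow U _ _) hmem) (le_csInf ⟨_, hmem⟩ ?_)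
  rintro L ⟨γ, hγ, hm, h0, h1, rfl⟩
  exact hf.artanh_le_integral hγ hm hw h0 h1 (hf.intervalIntegrable_kappa zero_le_one hγ hm)
    fun _ _ => le_rfl

/-- Riemann maps are isometries for the hyperbolic distances. -/
theorem hypDist_apply (hf : IsRiemannMap f U) {a b : ℂ} (ha : ‖a‖ < 1) (hb : ‖b‖ < 1) :
    hypDist U (f a) (f b) = discDist a b := by
  have h := (hf.comp_mob ha).hypDist_zero (norm_mob_lt_one (a := -a) (by simpa using ha) hb)
  rw [Function.comp_apply, Function.comp_apply, mob_zero, mob_mob_neg ha hb.le] at h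
  rw [h, discDist_eq_artanh ha hb]

theorem hypDist_eq (hf : IsRiemannMap f U) {z w : ℂ} (hz : z ∈ U) (hw : w ∈ U) :
    hypDist U z w = discDist (rinv f z) (rinv f w) := by
  have := hf.hypDist_apply (hf.norm_rinv_lt hz) (hf.norm_rinv_lt hw)
  rwa [hf.apply_rinv hz, hf.apply_rinv hw] at this

end IsRiemannMap

/-! ### Comparison with the upper half-plane -/

theorem cosh_dist_norm_mul_I (u : UpperHalfPlane) {y : ℝ} (hy : 0 < y) :
    Real.cosh (dist u (UpperHalfPlane.mk ⟨0, y⟩ hy)) =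
      (‖(u : ℂ)‖ ^ 2 + y ^ 2) / (2 * u.im * y) := by
  rw [UpperHalfPlane.cosh_dist', ← Complex.normSq_eq_norm_sq, Complex.normSq_apply]
  simp only [UpperHalfPlane.coe_re, UpperHalfPlane.coe_im]
  change ((u.re - 0) ^ 2 + u.im ^ 2 + y ^ 2) / (2 * u.im * y) = _
  congr 1
  ring

/-- `‖u‖ / u.im` is the hyperbolic cosine of the distance from `u` to the imaginary axis, attained
at the foot point `i‖u‖`. -/
theorem norm_div_im_le_cosh_dist (u : UpperHalfPlane) {y : ℝ} (hy : 0 < y) :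
    ‖(u : ℂ)‖ / u.im ≤ Real.cosh (dist u (UpperHalfPlane.mk ⟨0, y⟩ hy)) := by
  have hu := u.im_pos
  rw [cosh_dist_norm_mul_I, div_le_div_iff₀ hu (by positivity)]
  nlinarith [mul_nonneg hu.le (sq_nonneg (‖(u : ℂ)‖ - y))]

theorem dist_norm_mul_I_le (u : UpperHalfPlane) (hu : 0 < ‖(u : ℂ)‖) :
    dist u (UpperHalfPlane.mk ⟨0, ‖(u : ℂ)‖⟩ hu) ≤ ‖(u : ℂ)‖ / u.im := by
  have h : Real.cosh (dist u (UpperHalfPlane.mk ⟨0, ‖(u : ℂ)‖⟩ hu)) = ‖(u : ℂ)‖ / u.im := by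
    have := u.im_pos
    rw [cosh_dist_norm_mul_I]
    field_simp
    norm_num
  rw [← h]
  exact (Real.self_le_sinh_iff.2 dist_nonneg).trans (Real.sinh_lt_cosh _).le

theorem dist_mul_I (x y : ℝ) (hx : 0 < x) (hy : 0 < y) :
    dist (UpperHalfPlane.mk ⟨0, x⟩ hx) (UpperHalfPlane.mk ⟨0, y⟩ hy) =
      |Real.log x - Real.log y| :=
  UpperHalfPlane.dist_of_re_eq (z := .mk ⟨0, x⟩ hx) (w := .mk ⟨0, y⟩ hy) rfl

theorem cayley_im (w : ℂ) :
    (Complex.I * ((1 + w) / (1 - w))).im = (1 - ‖w‖ ^ 2) / ‖1 - w‖ ^ 2 := by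
  rw [Complex.I_mul_im, Complex.div_re, ← Complex.normSq_eq_norm_sq, ← Complex.normSq_eq_norm_sq,
    ← add_div]
  simp only [Complex.normSq_apply]
  simp
  congr 1
  ring

/-- The Cayley transform from the disc to the upper half-plane. -/
noncomputable def cayley (w : ℂ) (hw : ‖w‖ < 1) : UpperHalfPlane :=
  UpperHalfPlane.mk (Complex.I * ((1 + w) / (1 - w))) (by
    rw [cayley_im]
    have h1 := one_sub_sq_pos (norm_nonneg w) hw
    have h2 := norm_pos_iff.2 (Complex.slitPlane_ne_zero (one_sub_mem_slitPlane hw))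
    positivity)

theorem im_cayley {w : ℂ} (hw : ‖w‖ < 1) : (cayley w hw).im = (1 - ‖w‖ ^ 2) / ‖1 - w‖ ^ 2 :=
  cayley_im w

theorem norm_cayley {w : ℂ} (hw : ‖w‖ < 1) : ‖(cayley w hw : ℂ)‖ = ‖1 + w‖ / ‖1 - w‖ := by
  change ‖Complex.I * ((1 + w) / (1 - w))‖ = _
  simp

/-- The factor `2` reflects normalisations: the disc density here is `1 / (1 - |w|²)`, without the
`2` matching `1 / Im`. -/
theorem dist_cayley {a b : ℂ} (ha : ‖a‖ < 1) (hb : ‖b‖ < 1) :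
    dist (cayley a ha) (cayley b hb) = 2 * discDist a b := by
  have h1 := Complex.slitPlane_ne_zero (one_sub_mem_slitPlane ha)
  have h2 := Complex.slitPlane_ne_zero (one_sub_mem_slitPlane hb)
  have hd : dist (cayley a ha : ℂ) (cayley b hb : ℂ) = 2 * ‖a - b‖ / (‖1 - a‖ * ‖1 - b‖) := by
    change dist (Complex.I * ((1 + a) / (1 - a))) (Complex.I * ((1 + b) / (1 - b))) = _
    rw [dist_eq_norm, ← mul_sub, div_sub_div _ _ h1 h2,
      show (1 + a) * (1 - b) - (1 - a) * (1 + b) = 2 * (a - b) by ring]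
    simp
  have n1 := norm_pos_iff.2 h1
  have n2 := norm_pos_iff.2 h2
  have e : (1 - ‖a‖ ^ 2) / ‖1 - a‖ ^ 2 * ((1 - ‖b‖ ^ 2) / ‖1 - b‖ ^ 2) =
      ((1 - ‖a‖ ^ 2) * (1 - ‖b‖ ^ 2)) * ((‖1 - a‖ * ‖1 - b‖)⁻¹) ^ 2 := by
    field_simp
  have hpos := mul_pos (one_sub_sq_pos (norm_nonneg a) ha) (one_sub_sq_pos (norm_nonneg b) hb)
  rw [UpperHalfPlane.dist_eq, hd, im_cayley, im_cayley, e, Real.sqrt_mul hpos.le,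
    Real.sqrt_sq (by positivity), discDist]
  congr 2
  have := Real.sqrt_pos.2 hpos
  field_simp

/-- The reciprocal of the hyperbolic cosine of twice the distance to the real diameter. -/
noncomputable def axisCos (w : ℂ) : ℝ := (1 - ‖w‖ ^ 2) / ‖1 - w ^ 2‖

theorem axisCos_pos {w : ℂ} (hw : ‖w‖ < 1) : 0 < axisCos w :=
  div_pos (one_sub_sq_pos (norm_nonneg w) hw) (norm_pos_iff.2 (one_sub_sq_ne_zero hw))

theorem axisCos_ofReal {x : ℝ} (hx : ‖(x : ℂ)‖ < 1) : axisCos x = 1 := by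
  rw [Complex.norm_real, Real.norm_eq_abs] at hx
  have h : 0 < 1 - x ^ 2 := by rw [← sq_abs]; exact one_sub_sq_pos (abs_nonneg x) hx
  rw [axisCos, Complex.norm_real, Real.norm_eq_abs, sq_abs,
    show (1 : ℂ) - x ^ 2 = ((1 - x ^ 2 : ℝ) : ℂ) by push_cast; ring, Complex.norm_real,
    Real.norm_of_nonneg h.le, div_self h.ne']

theorem norm_cayley_div_im {w : ℂ} (hw : ‖w‖ < 1) :
    ‖(cayley w hw : ℂ)‖ / (cayley w hw).im = (axisCos w)⁻¹ := by
  have h1 := norm_pos_iff.2 (Complex.slitPlane_ne_zero (one_add_mem_slitPlane hw))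
  have h2 := norm_pos_iff.2 (Complex.slitPlane_ne_zero (one_sub_mem_slitPlane hw))
  have h3 := one_sub_sq_pos (norm_nonneg w) hw
  rw [norm_cayley, im_cayley, axisCos, show 1 - w ^ 2 = (1 + w) * (1 - w) by ring, norm_mul]
  field_simp

theorem norm_cayley_pos {w : ℂ} (hw : ‖w‖ < 1) : 0 < ‖(cayley w hw : ℂ)‖ :=
  norm_pos_iff.2 (cayley w hw).ne_zero

/-- Locates the foot point on the imaginary axis: the half-plane projection is the strip coordinate,
up to the factor `2`. -/
theorem log_norm_cayley {w : ℂ} (hw : ‖w‖ < 1) :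
    Real.log ‖(cayley w hw : ℂ)‖ = 2 * (stripMap w).re := by
  have h1 := norm_pos_iff.2 (Complex.slitPlane_ne_zero (one_add_mem_slitPlane hw))
  have h2 := norm_pos_iff.2 (Complex.slitPlane_ne_zero (one_sub_mem_slitPlane hw))
  rw [norm_cayley, Real.log_div h1.ne' h2.ne', stripMap_re]
  ring

/-- Near the real diameter the distance is controlled by the distance of the projections. -/
theorem discDist_le_of_axisCos_ge {a b : ℂ} (ha : ‖a‖ < 1) (hb : ‖b‖ < 1) {ε : ℝ} (hε : 0 < ε)
    (ha' : ε ≤ axisCos a) (hb' : ε ≤ axisCos b) :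
    discDist a b ≤ ε⁻¹ + |(stripMap a).re - (stripMap b).re| := by
  have h1 := dist_norm_mul_I_le (cayley a ha) (norm_cayley_pos ha)
  have h2 := dist_norm_mul_I_le (cayley b hb) (norm_cayley_pos hb)
  have h3 := dist_mul_I _ _ (norm_cayley_pos ha) (norm_cayley_pos hb)
  rw [log_norm_cayley, log_norm_cayley, ← mul_sub, abs_mul, abs_two] at h3
  rw [norm_cayley_div_im] at h1 h2
  have h4 : (axisCos a)⁻¹ ≤ ε⁻¹ := inv_anti₀ hε ha'
  have h5 : (axisCos b)⁻¹ ≤ ε⁻¹ := inv_anti₀ hε hb'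
  -- Go from `a` to its foot point, along the axis, and back out to `b`.
  have h6 := dist_triangle4 (cayley a ha) _ _ (cayley b hb) |>.trans
    (add_le_add (add_le_add h1 h3.le) ((dist_comm _ _).trans_le h2))
  rw [dist_cayley] at h6
  linarith

/-- In the half-plane, `b` is within `2 * M + ε⁻¹` of the foot point of `a`, hence of the axis. -/
theorem le_axisCos_of_discDist_le {a b : ℂ} (ha : ‖a‖ < 1) (hb : ‖b‖ < 1) {ε M : ℝ} (hε : 0 < ε)
    (ha' : ε ≤ axisCos a) (hM : discDist a b ≤ M) :
    (Real.cosh (2 * M + ε⁻¹))⁻¹ ≤ axisCos b := by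
  have h1 := dist_norm_mul_I_le (cayley a ha) (norm_cayley_pos ha)
  rw [norm_cayley_div_im] at h1
  have h4 : (axisCos a)⁻¹ ≤ ε⁻¹ := inv_anti₀ hε ha'
  have h2 := norm_div_im_le_cosh_dist (cayley b hb) (norm_cayley_pos ha)
  rw [norm_cayley_div_im] at h2
  have h3 := dist_triangle_left (cayley b hb)
    (UpperHalfPlane.mk ⟨0, ‖(cayley a ha : ℂ)‖⟩ (norm_cayley_pos ha)) (cayley a ha)
  rw [dist_cayley] at h3
  refine inv_le_of_inv_le₀ (axisCos_pos hb) (h2.trans ?_)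
  rw [Real.cosh_le_cosh, abs_of_nonneg dist_nonneg]
  exact le_trans (by linarith) (le_abs_self _)

/-! ### Stability of quasi-geodesics of the disc -/

theorem isRiemannMap_id : IsRiemannMap id (Metric.ball 0 1) :=
  ⟨differentiableOn_id, bijOn_id _⟩

theorem kappa_disc {a : ℂ} (ha : ‖a‖ < 1) (v : ℂ) :
    kappa (Metric.ball 0 1) a v = ‖v‖ / (1 - ‖a‖ ^ 2) := by
  simpa using isRiemannMap_id.kappa_apply ha v

theorem continuousOn_axisCos : ContinuousOn axisCos (Metric.ball 0 1) := by
  refine ContinuousOn.div (by fun_prop) (by fun_prop) fun w hw => ?_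
  exact norm_ne_zero_iff.2 (one_sub_sq_ne_zero (by simpa using hw))

/-- A non-negative projection means `‖1 - w‖ ≤ ‖1 + w‖`, so `‖1 + w‖ ≥ 1` and this factor can be
dropped from the denominator of `axisCos`. -/
theorem norm_one_sub_le_of_stripMap_re_nonneg {w : ℂ} (hw : ‖w‖ < 1) {δ : ℝ} (hδ : 0 < δ)
    (hq : δ ≤ axisCos w) (hX : 0 ≤ (stripMap w).re) : ‖1 - w‖ ≤ 2 / δ * (1 - ‖w‖) := by
  have n1 := norm_pos_iff.2 (Complex.slitPlane_ne_zero (one_add_mem_slitPlane hw))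
  have n2 := norm_pos_iff.2 (Complex.slitPlane_ne_zero (one_sub_mem_slitPlane hw))
  have h1 : ‖1 - w‖ ≤ ‖1 + w‖ := by
    rw [stripMap_re] at hX
    exact (Real.log_le_log_iff n2 n1).1 (by linarith)
  have h2 : 1 ≤ ‖1 + w‖ := by
    have : ‖(2 : ℂ)‖ ≤ ‖1 + w‖ + ‖1 - w‖ := by
      rw [show (2 : ℂ) = (1 + w) + (1 - w) by ring]; exact norm_add_le _ _
    rw [Complex.norm_ofNat] at this
    linarith
  rw [axisCos, show 1 - w ^ 2 = (1 + w) * (1 - w) by ring, norm_mul,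
    le_div_iff₀ (by positivity)] at hq
  rw [div_mul_eq_mul_div, le_div_iff₀ hδ]
  have h3 : δ * ‖1 - w‖ ≤ δ * (‖1 + w‖ * ‖1 - w‖) := by
    gcongr; exact le_mul_of_one_le_left n2.le h2
  nlinarith [norm_nonneg w]

/-- A curve in the disc, parametrized on `[0, +∞)` with a speed controlled by the density `m`, for
which the integral of `m` is at most the hyperbolic distance. -/
structure IsQuasiGeodesicRay (c : ℝ → ℂ) (m : ℝ → ℝ) (C : ℝ) : Prop where
  norm_lt : ∀ t, 0 ≤ t → ‖c t‖ < 1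
  contDiffOn : ContDiffOn ℝ 1 c (Ici 0)
  density_nonneg : ∀ t, 0 ≤ m t
  integrable : ∀ s t, 0 ≤ s → s ≤ t → IntervalIntegrable m volume s t
  speed_le : ∀ t, 0 < t → ‖deriv c t‖ ≤ C * m t * (1 - ‖c t‖ ^ 2)
  integral_le : ∀ s t, 0 ≤ s → s ≤ t → ∫ u in s..t, m u ≤ discDist (c s) (c t)

namespace IsQuasiGeodesicRay

variable {c : ℝ → ℂ} {m : ℝ → ℝ} {C : ℝ}

theorem isPiecewiseC1 (h : IsQuasiGeodesicRay c m C) {s t : ℝ} (hs : 0 ≤ s) (hst : s ≤ t) :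
    IsPiecewiseC1 c s t :=
  .of_contDiffOn hst (h.contDiffOn.mono fun _ hu => hs.trans hu.1)

theorem discDist_le (h : IsQuasiGeodesicRay c m C) {s t : ℝ} (hs : 0 ≤ s) (hst : s ≤ t) :
    discDist (c s) (c t) ≤ C * ∫ u in s..t, m u := by
  have ha := h.norm_lt s hs
  have hb := h.norm_lt t (hs.trans hst)
  have hg := isRiemannMap_id.comp_mob ha
  rw [discDist_eq_artanh ha hb, ← intervalIntegral.integral_const_mul]
  refine hg.artanh_le_integral (h.isPiecewiseC1 hs hst)
    (fun u hu => by simpa using h.norm_lt u (hs.trans hu.1))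
    (norm_mob_lt_one (by simpa using ha) hb) (by simp [mob_zero])
    (by simp [mob_mob_neg ha hb.le]) ((h.integrable s t hs hst).const_mul C) fun u hu => ?_
  have hu0 := hs.trans_lt hu.1
  rw [kappa_disc (h.norm_lt u hu0.le),
    div_le_iff₀ (one_sub_sq_pos (norm_nonneg _) (h.norm_lt u hu0.le))]
  exact h.speed_le u hu0

theorem rotate (h : IsQuasiGeodesicRay c m C) {e : ℂ} (he : ‖e‖ = 1) :
    IsQuasiGeodesicRay (fun t => e * c t) m C where
  norm_lt t ht := by simpa [he] using h.norm_lt t ht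
  contDiffOn := contDiffOn_const.mul h.contDiffOn
  density_nonneg := h.density_nonneg
  integrable := h.integrable
  speed_le t ht := by
    have hd : DifferentiableAt ℝ c t :=
      (h.contDiffOn.differentiableOn one_ne_zero).differentiableAt (Ici_mem_nhds ht)
    rw [deriv_const_mul _ hd, norm_mul, norm_mul, he, one_mul, one_mul]
    exact h.speed_le t ht
  integral_le s t hs hst := by rw [discDist_rotation he]; exact h.integral_le s t hs hst

/-- Far from the real diameter, the projection to it is contracting. -/
theorem abs_stripMap_sub_le (h : IsQuasiGeodesicRay c m C) (hC : 0 ≤ C) {s t ε : ℝ} (hs : 0 ≤ s)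
    (hst : s ≤ t) (hq : ∀ u ∈ Ioo s t, axisCos (c u) ≤ ε) :
    |(stripMap (c s)).re - (stripMap (c t)).re| ≤ ε * C * ∫ u in s..t, m u := by
  rw [abs_sub_comm, ← Complex.sub_re, ← intervalIntegral.integral_const_mul]
  refine (Complex.abs_re_le_norm _).trans ?_
  refine (h.isPiecewiseC1 hs hst).norm_sub_le_integral
    (V := Metric.ball 0 1) Metric.isOpen_ball
    (fun u hu => by simpa using h.norm_lt u (hs.trans hu.1)) (fun w hw => ?_)
    ((h.integrable s t hs hst).const_mul (ε * C)) fun u hu => ?_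
  · exact (hasDerivAt_stripMap (by simpa using hw)).differentiableAt.differentiableWithinAt
  have hu0 := hs.trans_lt hu.1
  have hn := h.norm_lt u hu0.le
  have hpos := norm_pos_iff.2 (one_sub_sq_ne_zero hn)
  rw [(hasDerivAt_stripMap hn).deriv, norm_inv]
  -- The ratio of `|stripMap'|` to the hyperbolic density is exactly `axisCos`.
  calc ‖1 - c u ^ 2‖⁻¹ * ‖deriv c u‖
      ≤ ‖1 - c u ^ 2‖⁻¹ * (C * m u * (1 - ‖c u‖ ^ 2)) := by gcongr; exact h.speed_le u hu0
    _ = axisCos (c u) * (C * m u) := by rw [axisCos]; field_simp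
    _ ≤ ε * (C * m u) := by
        gcongr
        · exact mul_nonneg hC (h.density_nonneg u)
        · exact hq u hu
    _ = ε * C * m u := by ring

theorem continuousOn_axisCos_comp (h : IsQuasiGeodesicRay c m C) :
    ContinuousOn (fun t => axisCos (c t)) (Ici 0) :=
  continuousOn_axisCos.comp h.contDiffOn.continuousOn fun t ht => by
    simpa using h.norm_lt t ht

/-- A quasi-geodesic that starts and ends near the real diameter stays near it. -/
theorem le_axisCos (h : IsQuasiGeodesicRay c m C) (hC : 1 ≤ C) {t T : ℝ} (ht : 0 ≤ t)
    (htT : t ≤ T) (h0 : axisCos (c 0) = 1) (hT : axisCos (c T) = 1) :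
    (Real.cosh (2 * (C * (4 * C)) + 2 * C))⁻¹ ≤ axisCos (c t) := by
  -- Chosen so that `ε * C = 1 / 2`: where `axisCos ≤ ε`, the projection moves at most at half the
  -- rate of `m`.
  set ε := (2 * C)⁻¹ with hε_def
  have hε : 0 < ε := by positivity
  have hε1 : ε ≤ 1 := inv_le_one_of_one_le₀ (by linarith)
  have hεC : ε⁻¹ = 2 * C := by rw [hε_def, inv_inv]
  have hcont := h.continuousOn_axisCos_comp
  -- `s` is the last time up to `t`, and `r` below the first time from `t` on, at which the curve is
  -- `ε`-close to the diameter.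
  obtain ⟨s, ⟨hs0, hst⟩, hsq, hs'⟩ : ∃ s ∈ Icc 0 t, ε ≤ axisCos (c s) ∧
      ∀ u ∈ Ioc s t, axisCos (c u) < ε := by
    have hcl : IsCompact {u ∈ Icc 0 t | ε ≤ axisCos (c u)} := by
      refine isCompact_Icc.of_isClosed_subset ?_ fun u hu => hu.1
      exact (hcont.mono Icc_subset_Ici_self).preimage_isClosed_of_isClosed isClosed_Icc isClosed_Ici
    obtain ⟨s, hs⟩ := hcl.exists_isGreatest ⟨0, ⟨le_rfl, ht⟩, by rw [h0]; exact hε1⟩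
    refine ⟨s, hs.1.1, hs.1.2, fun u hu => ?_⟩
    by_contra! hle
    exact absurd (hs.2 ⟨⟨hs.1.1.1.trans hu.1.le, hu.2⟩, hle⟩) (not_le.2 hu.1)
  obtain ⟨r, ⟨htr, hrT⟩, hrq, hr'⟩ : ∃ r ∈ Icc t T, ε ≤ axisCos (c r) ∧
      ∀ u ∈ Ico t r, axisCos (c u) < ε := by
    have hcl : IsCompact {u ∈ Icc t T | ε ≤ axisCos (c u)} := by
      refine isCompact_Icc.of_isClosed_subset ?_ fun u hu => hu.1
      exact (hcont.mono fun u hu => ht.trans hu.1).preimage_isClosed_of_isClosed isClosed_Icc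
        isClosed_Ici
    obtain ⟨r, hr⟩ := hcl.exists_isLeast ⟨T, ⟨htT, le_rfl⟩, by rw [hT]; exact hε1⟩
    refine ⟨r, hr.1.1, hr.1.2, fun u hu => ?_⟩
    by_contra! hle
    exact absurd (hr.2 ⟨⟨hu.1, hu.2.le.trans hr.1.1.2⟩, hle⟩) (not_le.2 hu.2)
  have hsr := hst.trans htr
  have hX := h.abs_stripMap_sub_le (by linarith) (ε := ε) hs0 hsr fun u hu => by
    rcases le_total u t with hut | hut
    · exact (hs' u ⟨hu.1, hut⟩).le
    · exact (hr' u ⟨hut, hu.2⟩).le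
  have hεC' : ε * C = 1 / 2 := by rw [hε_def]; field_simp
  have h1 := discDist_le_of_axisCos_ge (h.norm_lt s hs0) (h.norm_lt r (hs0.trans hsr)) hε hsq hrq
  have h2 := h.integral_le s r hs0 hsr
  rw [hεC'] at hX
  rw [hεC] at h1
  -- From `∫ m ≤ discDist ≤ 2 * C + (∫ m) / 2`.
  have h3 : ∫ u in s..r, m u ≤ 4 * C := by linarith
  have h4 : ∫ u in s..t, m u ≤ 4 * C := by
    refine le_trans ?_ h3
    exact intervalIntegral.integral_mono_interval le_rfl hst htr
      (Eventually.of_forall fun u => h.density_nonneg u) (h.integrable s r hs0 hsr)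
  have h5 : discDist (c s) (c t) ≤ C * (4 * C) :=
    (h.discDist_le hs0 hst).trans (by gcongr)
  have := le_axisCos_of_discDist_le (h.norm_lt s hs0) (h.norm_lt t ht) hε hsq h5
  rwa [hεC] at this

/-- A quasi-geodesic from `0` to a point of the positive real diameter stays in a Stolz region. -/
theorem norm_one_sub_le (h : IsQuasiGeodesicRay c m C) (hC : 1 ≤ C) {δ : ℝ} (hδ : 0 < δ)
    {t T : ℝ} (ht : 0 ≤ t) (htT : t ≤ T) (h0 : c 0 = 0) {x : ℝ} (hx : 0 ≤ x) (hT : c T = x)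
    (hq : ∀ u ∈ Icc 0 T, δ ≤ axisCos (c u)) :
    ‖1 - c t‖ ≤ max (2 / δ) (2 / (1 - Real.tanh (C * δ⁻¹))) * (1 - ‖c t‖) := by
  have hn := h.norm_lt t ht
  rcases le_or_gt 0 (stripMap (c t)).re with hX | hX
  · refine (norm_one_sub_le_of_stripMap_re_nonneg hn hδ (hq t ⟨ht, htT⟩) hX).trans ?_
    exact mul_le_mul_of_nonneg_right (le_max_left _ _) (by linarith)
  have hcont : ContinuousOn (fun u => (stripMap (c u)).re) (Icc t T) := by
    refine Complex.continuous_re.comp_continuousOn (ContinuousOn.comp (g := stripMap)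
      (t := Metric.ball 0 1) (fun w hw => ?_)
      (h.contDiffOn.continuousOn.mono fun u hu => ht.trans hu.1) fun u hu => ?_)
    · exact (hasDerivAt_stripMap (by simpa using hw)).continuousAt.continuousWithinAt
    · simpa using h.norm_lt u (ht.trans hu.1)
  have hXT : 0 ≤ (stripMap (c T)).re := by
    have := h.norm_lt T (ht.trans htT)
    rw [hT, Complex.norm_real, Real.norm_of_nonneg hx] at this
    rw [hT, stripMap_ofReal_re hx this]
    exact Real.artanh_nonneg hx
  -- If the projection at `t` is negative, it vanishes at some later `r`. Then `c r` is within `δ⁻¹`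
  -- of `0`, which bounds the integral of `m` up to `t` and confines `c t` to a fixed smaller disc.
  obtain ⟨r, ⟨htr, hrT⟩, hr⟩ := intermediate_value_Icc htT hcont ⟨hX.le, hXT⟩
  have hr0 := ht.trans htr
  have hδ1 : δ ≤ axisCos 0 := by rw [← h0]; exact hq 0 ⟨le_rfl, ht.trans htT⟩
  have h1 := discDist_le_of_axisCos_ge (a := 0) (by simp) (h.norm_lt r hr0) hδ hδ1 (hq r ⟨hr0, hrT⟩)
  simp only at hr
  rw [stripMap_zero, hr, Complex.zero_re, sub_zero, abs_zero, add_zero, ← h0] at h1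
  have h2 := h.integral_le 0 r le_rfl hr0
  have h3 : ∫ u in 0..t, m u ≤ δ⁻¹ := by
    refine le_trans ?_ (h2.trans h1)
    exact intervalIntegral.integral_mono_interval le_rfl ht htr
      (Eventually.of_forall fun u => h.density_nonneg u) (h.integrable 0 r le_rfl hr0)
  have h4 : discDist 0 (c t) ≤ C * δ⁻¹ := by
    rw [← h0]; exact (h.discDist_le le_rfl ht).trans (by gcongr)
  rw [discDist_zero_left hn] at h4
  have h5 : ‖c t‖ ≤ Real.tanh (C * δ⁻¹) := by
    have hmem : ‖c t‖ ∈ Ioo (-1 : ℝ) 1 := ⟨by linarith [norm_nonneg (c t)], hn⟩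
    rw [← Real.artanh_le_artanh_iff hmem ⟨Real.neg_one_lt_tanh _, Real.tanh_lt_one _⟩,
      Real.artanh_tanh]
    exact h4
  have h6 : ‖1 - c t‖ ≤ 2 := (norm_sub_le _ _).trans (by rw [norm_one]; linarith)
  have h7 : 0 < 1 - Real.tanh (C * δ⁻¹) := by linarith [Real.tanh_lt_one (C * δ⁻¹)]
  refine h6.trans (le_trans ?_ (mul_le_mul_of_nonneg_right (le_max_right _ _) (by linarith)))
  rw [div_mul_eq_mul_div, le_div_iff₀ h7]
  linarith

/-- A quasi-geodesic ray from `0` that leaves every compact set stays in a Stolz region. -/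
theorem exists_stolz (h : IsQuasiGeodesicRay c m C) (hC : 1 ≤ C) (h0 : c 0 = 0)
    (hne : ∀ᶠ T in atTop, c T ≠ 0) :
    ∃ σ : ℂ, ‖σ‖ = 1 ∧ ∃ M, ∀ t, 0 ≤ t → ‖σ - c t‖ ≤ M * (1 - ‖c t‖) := by
  set δ := (Real.cosh (2 * (C * (4 * C)) + 2 * C))⁻¹
  have hδ : 0 < δ := inv_pos.2 (Real.cosh_pos _)
  set M := max (2 / δ) (2 / (1 - Real.tanh (C * δ⁻¹)))
  -- `M` depends neither on `t` nor on `T`, so the vertex `c T / ‖c T‖` can be replaced by a cluster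
  -- point as `T → ∞`.
  have key : ∀ t T, 0 ≤ t → t ≤ T → c T ≠ 0 → ‖c T / ‖c T‖ - c t‖ ≤ M * (1 - ‖c t‖) := by
    intro t T ht htT hcT
    have hn : (‖c T‖ : ℂ) ≠ 0 := by simpa using hcT
    set e : ℂ := ‖c T‖ / c T with he_def
    have he : ‖e‖ = 1 := by simp [he_def, hcT]
    have hr := h.rotate he
    have hT : e * c T = (‖c T‖ : ℝ) := by simp [he_def, hcT]
    have hnT : ‖((‖c T‖ : ℝ) : ℂ)‖ < 1 := by simpa using h.norm_lt T (ht.trans htT)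
    have hq : ∀ u ∈ Icc 0 T, δ ≤ axisCos (e * c u) := fun u hu =>
      hr.le_axisCos hC hu.1 hu.2 (by simp [h0, axisCos]) (by
        simp only [hT]; exact axisCos_ofReal hnT)
    have := hr.norm_one_sub_le hC hδ ht htT (by simp [h0]) (norm_nonneg (c T)) hT hq
    rw [norm_mul, he, one_mul] at this
    convert this using 1
    rw [← one_mul ‖c T / _ - c t‖, ← he, ← norm_mul, mul_sub]
    congr 2
    rw [he_def]
    field_simp
  have hsph : ∃ᶠ T in atTop, c T / ‖c T‖ ∈ Metric.sphere (0 : ℂ) 1 := by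
    refine (hne.mono fun T hT => ?_).frequently
    simp [hT]
  obtain ⟨σ, hσ, hcl⟩ := (isCompact_sphere (0 : ℂ) 1).exists_mapClusterPt_of_frequently hsph
  refine ⟨σ, by simpa using hσ, M, fun t ht => ?_⟩
  have hcl' : IsClosed {e : ℂ | ‖e - c t‖ ≤ M * (1 - ‖c t‖)} :=
    isClosed_le (by fun_prop) continuous_const
  refine hcl'.mem_of_mapClusterPt hcl ?_
  filter_upwards [hne, eventually_ge_atTop t] with T hT htT
  exact key t T ht htT hT

end IsQuasiGeodesicRay

/-! ### From non-tangential convergence to hyperbolic sectors -/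

theorem discDist_unit_mul_tanh {e : ℂ} (he : ‖e‖ = 1) {s t : ℝ} (hst : s ≤ t) :
    discDist (e * (Real.tanh s : ℂ)) (e * (Real.tanh t : ℂ)) = t - s := by
  have hs := Real.cosh_pos s
  have ht := Real.cosh_pos t
  have hsqrt : √((1 - Real.tanh s ^ 2) * (1 - Real.tanh t ^ 2)) =
      (Real.cosh s * Real.cosh t)⁻¹ := by
    rw [one_sub_tanh_sq, one_sub_tanh_sq, ← mul_inv, ← mul_pow, ← inv_pow,
      Real.sqrt_sq (by positivity)]
  have hsinh : (Real.tanh t - Real.tanh s) / (Real.cosh s * Real.cosh t)⁻¹ =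
      Real.sinh (t - s) := by
    rw [Real.sinh_sub, Real.tanh_eq_sinh_div_cosh, Real.tanh_eq_sinh_div_cosh]
    field_simp
  have hnonneg : 0 ≤ Real.tanh t - Real.tanh s := by
    have h := Real.sinh_nonneg_iff.2 (sub_nonneg.2 hst)
    rw [← hsinh, div_inv_eq_mul] at h
    exact nonneg_of_mul_nonneg_left h (by positivity)
  rw [discDist_rotation he, discDist, ← Complex.ofReal_sub, Complex.norm_real, Complex.norm_real,
    Complex.norm_real, Real.norm_eq_abs, Real.norm_eq_abs, Real.norm_eq_abs, sq_abs, sq_abs, hsqrt,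
    abs_sub_comm, abs_of_nonneg hnonneg, hsinh, Real.arsinh_sinh]

theorem arsinh_le_self {x : ℝ} (hx : 0 ≤ x) : Real.arsinh x ≤ x := by
  rw [← Real.sinh_le_sinh, Real.sinh_arsinh]
  exact Real.self_le_sinh_iff.2 hx

/-- The two points have equal modulus, so the denominator in `discDist` is `1 - ‖w‖ ^ 2`; then
`arsinh x ≤ x` suffices. -/
theorem discDist_norm_mul_le {σ w : ℂ} (hσ : ‖σ‖ = 1) (hw : ‖w‖ < 1) {M : ℝ}
    (h : ‖σ - w‖ ≤ M * (1 - ‖w‖)) : discDist w (σ * ‖w‖) ≤ M + 1 := by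
  have h1 := one_sub_sq_pos (norm_nonneg w) hw
  have h2 : ‖w - σ * ‖w‖‖ ≤ (M + 1) * (1 - ‖w‖) := by
    have h3 : ‖σ * (1 - ‖w‖ : ℝ)‖ = 1 - ‖w‖ := by
      rw [norm_mul, hσ, one_mul, Complex.norm_real, Real.norm_of_nonneg (by linarith)]
    rw [show w - σ * ‖w‖ = σ * (1 - ‖w‖ : ℝ) - (σ - w) by push_cast; ring]
    refine (norm_sub_le _ _).trans ?_
    linarith
  have hM : 0 ≤ M + 1 := nonneg_of_mul_nonneg_left ((norm_nonneg _).trans h2) (by linarith)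
  rw [discDist, norm_mul, hσ, one_mul, Complex.norm_real, norm_norm, ← sq, Real.sqrt_sq h1.le]
  refine (arsinh_le_self (by positivity)).trans ?_
  rw [div_le_iff₀ h1]
  refine h2.trans (mul_le_mul_of_nonneg_left ?_ hM)
  nlinarith [norm_nonneg w]

theorem hypInfDist_le {U A : Set ℂ} {w a : ℂ} (ha : a ∈ A) : hypInfDist U w A ≤ hypDist U w a :=
  csInf_le ⟨0, by rintro _ ⟨b, -, rfl⟩; exact hypDist_nonneg _ _ _⟩ ⟨a, ha, rfl⟩

theorem isGeodesic_ray {f : ℂ → ℂ} {U : Set ℂ} (hf : IsRiemannMap f U) {e : ℂ} (he : ‖e‖ = 1) :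
    IsGeodesic U (fun t : ℝ => f (e * (Real.tanh (1 * t) : ℂ))) (Ici 0) := by
  refine ⟨fun t _ => hf.mem (norm_unit_mul_tanh_lt he _),
    (hf.contDiff_ray he 1).contDiffOn, fun t ht => ?_, fun s _ t _ hst => ?_⟩
  · rw [(hf.hasDerivAt_ray he 1 t).hasDerivWithinAt.derivWithin (uniqueDiffOn_Ici 0 t ht)]
    have he0 : e ≠ 0 := by rintro rfl; simp at he
    refine mul_ne_zero (hf.deriv_ne_zero (norm_unit_mul_tanh_lt he _))
      (mul_ne_zero he0 (Complex.ofReal_ne_zero.2 ?_))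
    have := Real.cosh_pos (1 * t)
    positivity
  · rw [hf.hypLength_ray he zero_le_one, hf.hypDist_apply (norm_unit_mul_tanh_lt he _)
      (norm_unit_mul_tanh_lt he _), discDist_unit_mul_tanh he (by linarith)]
    ring

theorem exists_sector_of_convergesNonTangentially {Δ : Set ℂ} {f : ℂ → ℂ} (hf : IsRiemannMap f Δ)
    {z : ℕ → ℂ} (hz : ∀ n, z n ∈ Δ) {σ : ℂ} (hσ : ‖σ‖ = 1)
    (h : ConvergesNonTangentially (fun n => rinv f (z n)) σ) :
    ∃ (γ : ℝ → ℂ) (R₀ : ℝ), IsGeodesic Δ γ (Ici 0) ∧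
      Tendsto (fun t => hypDist Δ (γ t) (γ 0)) atTop atTop ∧ 0 < R₀ ∧
      ∃ n₀ : ℕ, ∀ n ≥ n₀, z n ∈ sector Δ γ R₀ := by
  obtain ⟨-, M, hM, hev⟩ := h
  have hlt : ∀ t : ℝ, ‖σ * (Real.tanh (1 * t) : ℂ)‖ < 1 := fun t =>
    norm_unit_mul_tanh_lt hσ _
  refine ⟨_, M + 2, isGeodesic_ray hf hσ, ?_, by linarith, ?_⟩
  · refine tendsto_id.congr' ?_
    filter_upwards [eventually_ge_atTop 0] with t ht
    rw [hf.hypDist_apply (hlt t) (hlt 0), discDist_comm, discDist_unit_mul_tanh hσ (by linarith)]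
    simp
  · obtain ⟨n₀, hn₀⟩ := eventually_atTop.1 hev
    refine ⟨n₀, fun n hn => ⟨hz n, ?_⟩⟩
    obtain ⟨hlt1, hst⟩ := hn₀ n hn
    have hw : ‖rinv f (z n)‖ < 1 := hf.norm_rinv_lt (hz n)
    refine (hypInfDist_le (mem_image_of_mem _ (show Real.artanh ‖rinv f (z n)‖ ∈ Ici 0 from
      Real.artanh_nonneg (norm_nonneg _)))).trans_lt ?_
    have h1 := hf.hypDist_apply hw (hlt (Real.artanh ‖rinv f (z n)‖))
    rw [hf.apply_rinv (hz n)] at h1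
    rw [h1, one_mul, Real.tanh_artanh ⟨by linarith [norm_nonneg (rinv f (z n))], hw⟩]
    exact (discDist_norm_mul_le hσ hw hst.le).trans_lt (by linarith)

/-! ### From hyperbolic sectors to non-tangential convergence -/

namespace IsRiemannMap

variable {f : ℂ → ℂ} {U : Set ℂ}

theorem exists_apply_zero_eq (hf : IsRiemannMap f U) {z : ℂ} (hz : z ∈ U) :
    ∃ g, IsRiemannMap g U ∧ g 0 = z :=
  ⟨_, hf.comp_mob (hf.norm_rinv_lt hz), by simp [mob_zero, hf.apply_rinv hz]⟩

theorem hypDist_eq_artanh (hf : IsRiemannMap f U) {w : ℂ} (hw : w ∈ U) :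
    hypDist U (f 0) w = Real.artanh ‖rinv f w‖ := by
  have := hf.hypDist_zero (hf.norm_rinv_lt hw)
  rwa [hf.apply_rinv hw] at this

theorem hypDist_comm (hf : IsRiemannMap f U) {z w : ℂ} (hz : z ∈ U) (hw : w ∈ U) :
    hypDist U z w = hypDist U w z := by
  rw [hf.hypDist_eq hz hw, hf.hypDist_eq hw hz, discDist_comm]

/-- Schwarz–Pick for the inclusion `U ⊆ V`, with both Riemann maps centred at `z`. -/
theorem hypDist_le_of_subset {g : ℂ → ℂ} {V : Set ℂ} (hf : IsRiemannMap f U)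
    (hg : IsRiemannMap g V) (hUV : U ⊆ V) {z w : ℂ} (hz : z ∈ U) (hw : w ∈ U) :
    hypDist V z w ≤ hypDist U z w := by
  obtain ⟨f₁, hf₁, rfl⟩ := hf.exists_apply_zero_eq hz
  obtain ⟨g₁, hg₁, h0⟩ := hg.exists_apply_zero_eq (hUV hz)
  have h := hg₁.norm_rinv_le_of_mapsTo hf₁.1 h0.symm (hf₁.2.mapsTo.mono_right hUV)
    (hf₁.norm_rinv_lt hw)
  rw [hf₁.apply_rinv hw, div_one] at h
  rw [hf₁.hypDist_eq_artanh hw, ← h0, hg₁.hypDist_eq_artanh (hUV hw)]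
  exact Real.artanh_le_artanh (by linarith [norm_nonneg (rinv g₁ w)]) (hf₁.norm_rinv_lt hw) h

/-- Hyperbolic discs centred on `γ` lie in the sector around `γ`. -/
theorem mapsTo_sector (hf : IsRiemannMap f U) {γ : ℝ → ℂ} {t R : ℝ} (ht : 0 ≤ t)
    (h0 : f 0 = γ t) : MapsTo f (Metric.ball 0 (Real.tanh R)) (sector U γ R) := by
  intro w hw
  rw [mem_ball_zero_iff] at hw
  have hw1 : ‖w‖ < 1 := hw.trans (Real.tanh_lt_one R)
  refine ⟨hf.mem hw1, (hypInfDist_le (mem_image_of_mem γ ht)).trans_lt ?_⟩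
  rw [← h0, hf.hypDist_comm (hf.mem hw1) (hf.mem (by simp)), hf.hypDist_zero hw1,
    ← Real.artanh_tanh R]
  exact Real.artanh_lt_artanh (by linarith [norm_nonneg w]) (Real.tanh_lt_one R) hw

theorem mem_of_sector_subset {V : Set ℂ} (hf : IsRiemannMap f U) {γ : ℝ → ℂ}
    (hγ : MapsTo γ (Ici 0) U) {R : ℝ} (hR : 0 < R) (hsub : sector U γ R ⊆ V) {t : ℝ}
    (ht : 0 ≤ t) : γ t ∈ V := by
  obtain ⟨g, hg, h0⟩ := hf.exists_apply_zero_eq (hγ ht)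
  rw [← h0]
  exact hsub (hg.mapsTo_sector ht h0 (Metric.mem_ball_self (tanh_pos hR)))

/-- The Riemann map of `U` centred at `γ t` sends the disc of radius `tanh R` into the sector, hence
into `V`; apply the Schwarz lemma there. -/
theorem kappa_le_of_sector_subset {g : ℂ → ℂ} {V : Set ℂ} (hf : IsRiemannMap f U)
    (hg : IsRiemannMap g V) {γ : ℝ → ℂ} (hγ : MapsTo γ (Ici 0) U) {R : ℝ} (hR : 0 < R)
    (hsub : sector U γ R ⊆ V) {t : ℝ} (ht : 0 ≤ t) (v : ℂ) :
    kappa V (γ t) v ≤ (Real.tanh R)⁻¹ * kappa U (γ t) v := by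
  have hR' := tanh_pos hR
  obtain ⟨f₁, hf₁, h0⟩ := hf.exists_apply_zero_eq (hγ ht)
  obtain ⟨g₁, hg₁, h1⟩ := hg.exists_apply_zero_eq (hf.mem_of_sector_subset hγ hR hsub ht)
  have h := hg₁.norm_deriv_le_of_mapsTo hR'
    (hf₁.1.mono (Metric.ball_subset_ball (Real.tanh_lt_one R).le)) (h0.trans h1.symm)
    ((hf₁.mapsTo_sector ht h0).mono_right hsub)
  have k1 := hf₁.kappa_apply (a := 0) (by simp) v
  have k2 := hg₁.kappa_apply (a := 0) (by simp) v
  have p1 := norm_pos_iff.2 (hf₁.deriv_ne_zero (z := 0) (by simp))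
  have p2 := norm_pos_iff.2 (hg₁.deriv_ne_zero (z := 0) (by simp))
  rw [h0] at k1
  rw [h1] at k2
  rw [k1, k2]
  simp only [norm_zero, ne_eq, OfNat.ofNat_ne_zero, not_false_eq_true, zero_pow, sub_zero, mul_one]
  rw [inv_mul_eq_div, div_div]
  rw [le_div_iff₀ hR'] at h
  gcongr

/-- The same Schwarz lemma for distances; `R₀ < R` keeps the ratio of the tangents below `1`. -/
theorem hypDist_le_of_sector_subset {g : ℂ → ℂ} {V : Set ℂ} (hf : IsRiemannMap f U)
    (hg : IsRiemannMap g V) {γ : ℝ → ℂ} (hγ : MapsTo γ (Ici 0) U) {R R₀ : ℝ} (hR₀ : 0 < R₀)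
    (hR : R₀ < R) (hsub : sector U γ R ⊆ V) {t : ℝ} (ht : 0 ≤ t) {w : ℂ} (hw : w ∈ U)
    (hwt : hypDist U w (γ t) < R₀) :
    hypDist V (γ t) w ≤ Real.artanh (Real.tanh R₀ / Real.tanh R) := by
  have hR' := tanh_pos (hR₀.trans hR)
  obtain ⟨f₁, hf₁, h0⟩ := hf.exists_apply_zero_eq (hγ ht)
  obtain ⟨g₁, hg₁, h1⟩ := hg.exists_apply_zero_eq
    (hf.mem_of_sector_subset hγ (hR₀.trans hR) hsub ht)
  have hlt := tanh_lt_tanh hR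
  have hn : ‖rinv f₁ w‖ < Real.tanh R₀ := by
    rw [hf.hypDist_comm hw (hγ ht), ← h0, hf₁.hypDist_eq_artanh hw] at hwt
    rw [← Real.artanh_lt_artanh_iff ⟨by linarith [norm_nonneg (rinv f₁ w)], hf₁.norm_rinv_lt hw⟩
      ⟨Real.neg_one_lt_tanh _, Real.tanh_lt_one _⟩, Real.artanh_tanh]
    exact hwt
  have hmaps := (hf₁.mapsTo_sector ht h0).mono_right hsub
  have h := hg₁.norm_rinv_le_of_mapsTo
    (hf₁.1.mono (Metric.ball_subset_ball (Real.tanh_lt_one R).le)) (h0.trans h1.symm) hmaps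
    (hn.trans hlt)
  have hwV : w ∈ V := by
    have := hmaps (show rinv f₁ w ∈ Metric.ball 0 (Real.tanh R) by simpa using hn.trans hlt)
    rwa [hf₁.apply_rinv hw] at this
  rw [hf₁.apply_rinv hw] at h
  rw [← h1, hg₁.hypDist_eq_artanh hwV]
  refine Real.artanh_le_artanh (by linarith [norm_nonneg (rinv g₁ w)]) ((div_lt_one hR').2 hlt)
    (h.trans ?_)
  gcongr

/-- The pull-back of a geodesic of a larger domain is a quasi-geodesic of the disc. -/
theorem isQuasiGeodesicRay {g : ℂ → ℂ} {V : Set ℂ} (hf : IsRiemannMap f U)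
    (hg : IsRiemannMap g V) {γ : ℝ → ℂ} (hγ : IsGeodesic U γ (Ici 0)) {R : ℝ} (hR : 0 < R)
    (hsub : sector U γ R ⊆ V) (hVU : V ⊆ U) :
    IsQuasiGeodesicRay (fun t => rinv g (γ t)) (fun t => kappa U (γ t) (deriv γ t))
      (Real.tanh R)⁻¹ := by
  obtain ⟨hmaps, hC1, -, hlen⟩ := hγ
  have hmem : MapsTo γ (Ici 0) V := fun t ht => hf.mem_of_sector_subset hmaps hR hsub ht
  refine ⟨fun t ht => hg.norm_rinv_lt (hmem ht), ?_, fun t => kappa_nonneg _ _ _, ?_, ?_, ?_⟩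
  · have h1 : ContDiffOn ℝ 1 (rinv g) V :=
      (hg.differentiableOn_rinv.contDiffOn hg.isOpen).restrict_scalars ℝ
    exact h1.comp hC1 hmem
  · intro s t hs hst
    have hss : Icc s t ⊆ Ici 0 := fun u hu => hs.trans hu.1
    exact hf.intervalIntegrable_kappa hst (.of_contDiffOn hst (hC1.mono hss))
      (hmaps.mono_left hss)
  · intro t ht
    have hd : DifferentiableAt ℝ γ t :=
      (hC1.differentiableOn one_ne_zero).differentiableAt (Ici_mem_nhds ht)
    have hder : HasDerivAt (fun t => rinv g (γ t))
        ((deriv g (rinv g (γ t)))⁻¹ * deriv γ t) t :=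
      (hg.hasDerivAt_rinv (hmem ht.le)).comp_of_eq t hd.hasDerivAt rfl
    have hk := hf.kappa_le_of_sector_subset hg hmaps hR hsub ht.le (deriv γ t)
    have hn := one_sub_sq_pos (norm_nonneg _) (hg.norm_rinv_lt (hmem ht.le))
    rw [hg.kappa_eq (hmem ht.le)] at hk
    refine le_trans (le_of_eq ?_) (mul_le_mul_of_nonneg_right hk hn.le)
    rw [hder.deriv, norm_mul, norm_inv]
    field_simp
  · intro s t hs hst
    have h := hlen s hs t (hs.trans hst) hst
    rw [hypLength] at h
    rw [h, ← hg.hypDist_eq (hmem hs) (hmem (hs.trans hst))]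
    exact hg.hypDist_le_of_subset hf hVU (hmem hs) (hmem (hs.trans hst))

/-- Otherwise the preimages cluster at a point of the disc, and `f` carries it to an accumulation
point of `z` in `U`. -/
theorem tendsto_norm_rinv (hf : IsRiemannMap f U) {z : ℕ → ℂ} (hz : ∀ n, z n ∈ U)
    (hdiv : CompactlyDivergent U z) : Tendsto (fun n => ‖rinv f (z n)‖) atTop (𝓝 1) := by
  rw [tendsto_order]
  refine ⟨fun r hr => ?_, fun r hr => Eventually.of_forall fun n =>
    (hf.norm_rinv_lt (hz n)).trans hr⟩
  by_contra hnot
  rw [not_eventually] at hnot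
  have hfr : ∃ᶠ n in atTop, rinv f (z n) ∈ Metric.closedBall (0 : ℂ) r :=
    hnot.mono fun n hn => by simpa using hn
  obtain ⟨w, hw, hcl⟩ := (isCompact_closedBall (0 : ℂ) r).exists_mapClusterPt_of_frequently hfr
  have hw1 : ‖w‖ < 1 := lt_of_le_of_lt (by simpa using hw) hr
  have := hcl.continuousAt_comp (hf.differentiableAt hw1).continuousAt
  rw [show f ∘ (fun n => rinv f (z n)) = z from funext fun n => hf.apply_rinv (hz n)] at this
  exact hdiv _ (hf.mem hw1) this

theorem rinv_eq_mob (hf : IsRiemannMap f U) {a w : ℂ} (ha : ‖a‖ < 1) (hw : w ∈ U) :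
    rinv f w = mob a (rinv (f ∘ mob a) w) := by
  have h := hf.comp_mob ha
  have h1 := h.apply_rinv hw
  rw [Function.comp_apply] at h1
  conv_lhs => rw [← h1]
  exact hf.rinv_apply (norm_mob_lt_one ha (h.norm_rinv_lt hw))

end IsRiemannMap

/-- Stolz regions absorb hyperbolic neighbourhoods. -/
theorem stolz_of_discDist_le {a b σ : ℂ} (ha : ‖a‖ < 1) (hb : ‖b‖ < 1) {ρ M : ℝ} (hρ0 : 0 ≤ ρ)
    (hρ : ρ < 1) (hd : discDist a b ≤ Real.artanh ρ) (hM : ‖σ - a‖ ≤ M * (1 - ‖a‖)) :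
    ‖σ - b‖ ≤ (M * (1 + 2 * ρ / (1 - ρ)) + 2 * ρ / (1 - ρ)) * (1 - ‖b‖) := by
  have ha' : ‖-a‖ < 1 := by simpa using ha
  have hM0 : 0 ≤ M := nonneg_of_mul_nonneg_left ((norm_nonneg _).trans hM) (by linarith)
  set k := 2 * ρ / (1 - ρ) with hk
  rw [discDist_eq_artanh ha hb, Real.artanh_le_artanh_iff
    ⟨by linarith [norm_nonneg (mob (-a) b)], norm_mob_lt_one ha' hb⟩ ⟨by linarith, hρ⟩, mob,
    norm_div, div_le_iff₀ (norm_pos_iff.2 (one_add_conj_mul_ne_zero ha' hb.le))] at hd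
  -- Expanding about `b` instead of `a` gives `(1 - ρ) * ‖b - a‖ ≤ ρ * (1 - ‖b‖ ^ 2)`, a bound in
  -- terms of `b` alone.
  have h1 : ‖1 + conj (-a) * b‖ ≤ (1 - ‖b‖ ^ 2) + ‖b + -a‖ * ‖b‖ := by
    rw [show 1 + conj (-a) * b = (1 - conj b * b) + conj (b + -a) * b by
      rw [map_add]; ring]
    refine (norm_add_le _ _).trans ?_
    rw [norm_one_sub_conj_mul_self hb, norm_mul, Complex.norm_conj]
  have h2 : ‖b + -a‖ ≤ k * (1 - ‖b‖) := by
    rw [hk, div_mul_eq_mul_div, le_div_iff₀ (by linarith)]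
    have h3 : ρ * ‖1 + conj (-a) * b‖ ≤ ρ * ((1 - ‖b‖ ^ 2) + ‖b + -a‖ * ‖b‖) := by gcongr
    nlinarith [norm_nonneg b, norm_nonneg (b + -a), mul_nonneg hρ0 (norm_nonneg (b + -a)),
      mul_nonneg hρ0 (sq_nonneg (1 - ‖b‖))]
  have h4 : ‖b‖ - ‖a‖ ≤ ‖b + -a‖ := by rw [← sub_eq_add_neg]; exact norm_sub_norm_le b a
  have h5 : ‖σ - b‖ ≤ ‖σ - a‖ + ‖b + -a‖ := by
    rw [show σ - b = (σ - a) - (b + -a) by ring]; exact norm_sub_le _ _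
  have h6 : M * (1 - ‖a‖) ≤ M * ((1 + k) * (1 - ‖b‖)) := by
    have : ‖b‖ - ‖a‖ ≤ k * (1 - ‖b‖) := h4.trans h2
    gcongr
    linarith
  linarith

/-- Stolz regions are mapped into Stolz regions by automorphisms of the disc. -/
theorem stolz_mob {a b σ : ℂ} (ha : ‖a‖ < 1) (hb : ‖b‖ < 1) (hσ : ‖σ‖ = 1) {M : ℝ}
    (hM : ‖σ - b‖ ≤ M * (1 - ‖b‖)) :
    ‖mob a σ - mob a b‖ ≤ 4 * M / (1 - ‖a‖) * (1 - ‖mob a b‖) := by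
  have hM0 : 0 ≤ M := nonneg_of_mul_nonneg_left ((norm_nonneg _).trans hM) (by linarith)
  have h1 := norm_pos_iff.2 (one_add_conj_mul_ne_zero ha hσ.le)
  have h2 := norm_pos_iff.2 (one_add_conj_mul_ne_zero ha hb.le)
  have h3 := one_sub_sq_norm_mob ha hb.le
  have h4 := norm_mob_lt_one ha hb
  have h5 := one_sub_sq_pos (norm_nonneg a) ha
  have h6 : 1 - ‖a‖ ≤ ‖1 + conj a * σ‖ := by
    have := norm_sub_norm_le (1 : ℂ) (-(conj a * σ))
    simpa [hσ] using this
  have h7 : ‖1 + conj a * b‖ ≤ 2 := by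
    refine (norm_add_le _ _).trans ?_
    rw [norm_one, norm_mul, Complex.norm_conj]
    nlinarith [norm_nonneg a, norm_nonneg b]
  have h8 : (1 - ‖a‖ ^ 2) * (1 - ‖b‖) / ‖1 + conj a * b‖ ^ 2 ≤ 2 * (1 - ‖mob a b‖) := by
    have h9 : (1 - ‖a‖ ^ 2) * (1 - ‖b‖) / ‖1 + conj a * b‖ ^ 2 ≤ 1 - ‖mob a b‖ ^ 2 := by
      rw [h3]
      gcongr
      nlinarith [norm_nonneg b]
    nlinarith [norm_nonneg (mob a b)]
  rw [mob_sub_mob ha hσ.le hb.le, norm_div, norm_mul, norm_mul, norm_one_sub_conj_mul_self ha]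
  have ha1 : 0 < 1 - ‖a‖ := by linarith
  have hb1 : 0 < 1 - ‖b‖ := by linarith
  generalize ‖1 + conj a * σ‖ = x at *
  generalize ‖1 + conj a * b‖ = y at *
  -- The `4` combines `y ≤ 2` with `1 - ‖mob a b‖ ^ 2 ≤ 2 * (1 - ‖mob a b‖)`.
  calc (1 - ‖a‖ ^ 2) * ‖σ - b‖ / (x * y)
      ≤ (1 - ‖a‖ ^ 2) * (M * (1 - ‖b‖)) / ((1 - ‖a‖) * y) := by gcongr
    _ = M * y / (1 - ‖a‖) * ((1 - ‖a‖ ^ 2) * (1 - ‖b‖) / y ^ 2) := by field_simp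
    _ ≤ M * 2 / (1 - ‖a‖) * (2 * (1 - ‖mob a b‖)) := by gcongr
    _ = 4 * M / (1 - ‖a‖) * (1 - ‖mob a b‖) := by ring

theorem norm_mob_eq_one {a σ : ℂ} (ha : ‖a‖ < 1) (hσ : ‖σ‖ = 1) : ‖mob a σ‖ = 1 := by
  have h := one_sub_sq_norm_mob ha hσ.le
  rw [hσ] at h
  have h1 : ‖mob a σ‖ ^ 2 = 1 := by
    have : (1 - ‖a‖ ^ 2) * (1 - 1 ^ 2) / ‖1 + conj a * σ‖ ^ 2 = 0 := by simp
    linarith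
  exact (pow_eq_one_iff_of_nonneg (norm_nonneg _) two_ne_zero).1 h1

theorem convergesNonTangentially_of_stolz {ζ : ℕ → ℂ} {σ : ℂ} {M : ℝ} (hζ : ∀ n, ‖ζ n‖ < 1)
    (hlim : Tendsto (fun n => ‖ζ n‖) atTop (𝓝 1))
    (h : ∀ᶠ n in atTop, ‖σ - ζ n‖ ≤ M * (1 - ‖ζ n‖)) : ConvergesNonTangentially ζ σ := by
  constructor
  · rw [tendsto_iff_norm_sub_tendsto_zero]
    have h0 : Tendsto (fun n => M * (1 - ‖ζ n‖)) atTop (𝓝 0) := by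
      simpa using (hlim.const_sub 1).const_mul M
    refine squeeze_zero' (Eventually.of_forall fun n => norm_nonneg _) ?_ h0
    filter_upwards [h] with n hn
    rwa [norm_sub_rev]
  · refine ⟨max M 1 + 1, by linarith [le_max_right M 1], ?_⟩
    filter_upwards [h] with n hn
    refine ⟨by simpa using hζ n, hn.trans_lt ?_⟩
    exact mul_lt_mul_of_pos_right (by linarith [le_max_left M 1]) (by linarith [hζ n])

theorem exists_convergesNonTangentially_of_sector {Δ U : Set ℂ} {f : ℂ → ℂ}
    (hf : IsRiemannMap f Δ) (hU : IsProperSCDomain U) {z : ℕ → ℂ}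
    (hz : ∀ n, z n ∈ Δ) (hdiv : CompactlyDivergent Δ z) {γ : ℝ → ℂ} {R R₀ : ℝ}
    (hγ : IsGeodesic U γ (Ici 0))
    (hinf : Tendsto (fun t => hypDist U (γ t) (γ 0)) atTop atTop) (hR₀ : 0 < R₀) (hR : R₀ < R)
    (hsub : sector U γ R ⊆ Δ) (hΔU : Δ ⊆ U) {n₀ : ℕ} (hn₀ : ∀ n ≥ n₀, z n ∈ sector U γ R₀) :
    ∃ σ : ℂ, ‖σ‖ = 1 ∧ ConvergesNonTangentially (fun n => rinv f (z n)) σ := by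
  have hR0 := hR₀.trans hR
  have hRt := tanh_pos hR0
  have hpos := hinf.eventually_gt_atTop 0
  obtain ⟨g, hg⟩ := exists_isRiemannMap hU
  have hmem : ∀ t, 0 ≤ t → γ t ∈ Δ := fun t ht => hg.mem_of_sector_subset hγ.1 hR0 hsub ht
  have ha := hf.norm_rinv_lt (hmem 0 le_rfl)
  set a := rinv f (γ 0) with ha_def
  -- Recentring at `γ 0` makes the pulled-back ray start at `0`; `mob a` undoes this at the end.
  have hf₁ := hf.comp_mob ha
  set f₁ := f ∘ mob a with hf₁_def
  have h0 : rinv f₁ (γ 0) = 0 := by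
    have : f₁ 0 = γ 0 := by simp [hf₁_def, mob_zero, ha_def, hf.apply_rinv (hmem 0 le_rfl)]
    rw [← this, hf₁.rinv_apply (by simp)]
  have hq := hg.isQuasiGeodesicRay hf₁ hγ hR0 hsub hΔU
  obtain ⟨σ, hσ, M, hM⟩ := hq.exists_stolz
    ((one_le_inv₀ hRt).2 (Real.tanh_lt_one R).le) h0 (by
      filter_upwards [hpos, eventually_ge_atTop 0] with t ht ht0 hc
      -- A return to `0` is excluded for large `t`, since `k_Δ ≥ k_U > 0` between `γ t` and `γ 0`.
      have h1 := hf₁.hypDist_le_of_subset hg hΔU (hmem t ht0) (hmem 0 le_rfl)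
      rw [hf₁.hypDist_eq (hmem t ht0) (hmem 0 le_rfl), h0, hc] at h1
      have : discDist 0 0 = 0 := by simp [discDist]
      linarith)
  have hR₀t := tanh_pos hR₀
  set ρ := Real.tanh R₀ / Real.tanh R
  have hρ : ρ < 1 := (div_lt_one hRt).2 (tanh_lt_tanh hR)
  refine ⟨mob a σ, norm_mob_eq_one ha hσ, convergesNonTangentially_of_stolz
    (M := 4 * (M * (1 + 2 * ρ / (1 - ρ)) + 2 * ρ / (1 - ρ)) / (1 - ‖a‖))
    (fun n => hf.norm_rinv_lt (hz n)) (hf.tendsto_norm_rinv hz hdiv) ?_⟩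
  filter_upwards [eventually_ge_atTop n₀] with n hn
  obtain ⟨hzU, hinfd⟩ := hn₀ n hn
  obtain ⟨_, ⟨_, ⟨t, ht, rfl⟩, rfl⟩, hlt⟩ := exists_lt_of_csInf_lt
    ((nonempty_Ici.image γ).image (hypDist U (z n))) hinfd
  have hd := hg.hypDist_le_of_sector_subset hf₁ hγ.1 hR₀ hR hsub ht hzU hlt
  rw [hf₁.hypDist_eq (hmem t ht) (hz n)] at hd
  have hst := stolz_of_discDist_le (hf₁.norm_rinv_lt (hmem t ht)) (hf₁.norm_rinv_lt (hz n))
    (by positivity) hρ hd (hM t ht)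
  rw [hf.rinv_eq_mob ha (hz n)]
  exact stolz_mob ha (hf₁.norm_rinv_lt (hz n)) hσ hst

end HypSector

/-! ### The equivalence. -/

theorem theorem1p1 (Δ : Set ℂ) (hΔ : HypSector.IsProperSCDomain Δ)
    (f : ℂ → ℂ) (hf : HypSector.IsRiemannMap f Δ)
    (z : ℕ → ℂ) (hz : ∀ n, z n ∈ Δ) (hdiv : HypSector.CompactlyDivergent Δ z) :
    (∃ σ ∈ Metric.sphere (0 : ℂ) 1, HypSector.ConvergesNonTangentially
        (fun n => Function.invFunOn f (Metric.ball 0 1) (z n)) σ) ↔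
      ∃ (U : Set ℂ) (γ : ℝ → ℂ) (R R₀ : ℝ),
        HypSector.IsProperSCDomain U ∧
        HypSector.IsGeodesic U γ (Set.Ici 0) ∧
        Filter.Tendsto (fun t => HypSector.hypDist U (γ t) (γ 0)) Filter.atTop Filter.atTop ∧
        0 < R₀ ∧ R₀ < R ∧
        HypSector.sector U γ R ⊆ Δ ∧ Δ ⊆ U ∧
        ∃ n₀ : ℕ, ∀ n ≥ n₀, z n ∈ HypSector.sector U γ R₀ := by
  constructor
  · rintro ⟨σ, hσ, h⟩
    obtain ⟨γ, R₀, hγ, hinf, hR₀, hn₀⟩ :=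
      HypSector.exists_sector_of_convergesNonTangentially hf hz (by simpa using hσ) h
    -- With `U = Δ` every sector lies in `Δ`, so any amplitude above `R₀` will do.
    exact ⟨Δ, γ, R₀ + 1, R₀, hΔ, hγ, hinf, hR₀, by linarith, fun w hw => hw.1, Subset.rfl, hn₀⟩
  · rintro ⟨U, γ, R, R₀, hU, hγ, hinf, hR₀, hR, hsub, hΔU, n₀, hn₀⟩
    obtain ⟨σ, hσ, h⟩ := HypSector.exists_convergesNonTangentially_of_sector hf hU hz hdiv hγ
      hinf hR₀ hR hsub hΔU hn₀
    exact ⟨σ, by simpa using hσ, h⟩
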